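/- **Setting.** Let $X$ be a measurable space and $H$ a class of measurable classifiers $X\to\{0,1\}$ of finite VC dimension $d$; all labels are given by an unknown target $c\in H$. For $T\ge 0$ let $d_{\rm boost}=d_{\rm boost}(T)$ be the VC dimension of the class of weighted majority votes $x\mapsto \mathbf 1[\sum_{t\le T}\alpha_t h_t(x)\ge \frac12\sum_{t\le T}\alpha_t]$ with $h_t\in H$, $\alpha_t\ge 0$. *AdaBoost* with parameters $T,n,m$ draws a reservoir $S$ of $m$ labelled points from a distribution $\mu$ and gives them equal weights. In each of up to $T$ rounds it draws $n$ points of $S$ independently, with replacement, proportionally to the weights, and runs on them a fixed weak learner $A$, which returns a member of $H$ consistent with its input and for which $(z,x)\mapsto A(z)(x)$ is measurable. If the returned $h_t$ has weighted error $e_t=0$ on $S$, the output is $h_t$; if $e_t\ge\frac12$, boosting stops; otherwise, with $\beta_t=e_t/(1-e_t)$, the weights of the correctly classified points are multiplied by $\beta_t$, and $h_t$ gets vote $\alpha_t=\ln(1/\beta_t)$. Unless some $e_t=0$, the output is the weighted majority vote of the hypotheses so far. *Distributed Boosting with preprocessing*, for $k$ players with distributions $D_1,\dots,D_k$ on $X$: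 the center first makes $m$ draws from the uniform multinomial distribution on the players, and player $i$ fills a reservoir $S_i$ with as many i.i.d. labelled points of $D_i$ as $i$ was drawn, so that $\sum_i|S_i|=m$. Then it proceeds as AdaBoost on $\bigcup_i S_i$, except that in each round the center determines how many points to request from each player by $n$ multinomial draws with probabilities proportional to the total weights of the reservoirs $S_i$, and each player draws the requested number of points from its own $S_i$, independently, with replacement, proportionally to the weights. The *sample complexity* (for $A,T,n,\varepsilon,\delta$) is the least $m\ge 1$ such that, for every reservoir size $m'\ge m$, every target in $H$ and all distributions, the output has error less than $\varepsilon$ (on $\mu$, respectively on the uniform mixture $\frac1k\sum_i D_i$) with probability at least $1-\delta$. **Statement.** There are absolute constants $C,C'>0$ such that for all such $X,H,d$, all $0<\varepsilon,\delta<1$, all $T\ge C\ln\frac2\varepsilon$: $d_{\rm boost}(T)$ is finite, and for all $n\ge C(d+\ln\frac{2T}{\delta})$, all such weak learners $A$ and all $k\ge 1$, the sample complexity of Distributed Boosting with $k$ players and preprocessing equals the sample complexity $m_{\rm boost}$ of centralized AdaBoost, and is at most $$\left\lceil \frac{C}{\varepsilon}\Big(d_{\rm boost}\ln\frac2\varepsilon+\ln\frac2\delta\Big)\right\rceil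 .$$ Moreover, for $T=\lceil C\ln\frac2\varepsilon\rceil$, $$\frac{C}{\varepsilon}\Big(d_{\rm boost}\ln\frac2\varepsilon+\ln\frac2\delta\Big)\le C'\,\frac{d+\ln(2/\delta)}{\varepsilon}\,\ln^3\frac2\varepsilon ,$$ so that the sample complexity is $\tilde O(d_{\rm boost}/\varepsilon)=\tilde O(d/\varepsilon)$. None of the bounds depends on $k$. -/

import Mathlib

open MeasureTheory
open scoped ENNReal

noncomputable section

namespace DistBoost

/-! ### VC dimension of a class of binary classifiers -/

/-- `H` shatters the finite set `s`: every labelling of `s` is realised by a member of `H`. -/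
def Shatters {X : Type*} (H : Set (X → Bool)) (s : Finset X) : Prop :=
  ∀ g : X → Bool, ∃ h ∈ H, ∀ x ∈ s, h x = g x

/-- The VC dimension, `⊤` if arbitrarily large finite sets are shattered. -/
def vcDim {X : Type*} (H : Set (X → Bool)) : ℕ∞ :=
  ⨆ (s : Finset X) (_ : Shatters H s), (s.card : ℕ∞)

/-- The hypothesis class after `T` rounds of boosting: the weighted majority votes
`x ↦ [∑ t, α t * h t x ≥ (1/2) ∑ t, α t]` of `T` members of `H`. -/
def boostedClass {X : Type*} (H : Set (X → Bool)) (T : ℕ) : Set (X → Bool) :=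
  {f | ∃ (h : Fin T → X → Bool) (α : Fin T → ℝ), (∀ t, h t ∈ H) ∧ (∀ t, 0 ≤ α t) ∧
    ∀ x, (f x = true ↔ (1 / 2) * ∑ t, α t ≤ ∑ t, α t * (if h t x then 1 else 0))}

/-! ### Finite random draws -/

/-- A draw from a finite type with probabilities proportional to the nonnegative weights `w`
(a fixed element if the total weight is zero). -/
def draw {ι : Type*} [Fintype ι] [Nonempty ι] (w : ι → ℝ) : PMF ι :=
  open Classical in
  if hw : ∑ i, ENNReal.ofReal (w i) = 0 then PMF.pure (Classical.arbitrary ι)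
  else PMF.normalize (fun i => ENNReal.ofReal (w i))
    (by rwa [tsum_fintype])
    (by rw [tsum_fintype]; exact ENNReal.sum_ne_top.2 fun _ _ => ENNReal.ofReal_ne_top)

/-- Independent draws, the `j`-th one from `p j`. -/
def indepDraws {ι : Type*} [Fintype ι] {n : ℕ} (p : Fin n → PMF ι) : PMF (Fin n → ι) :=
  PMF.ofFintype (fun f => ∏ j, p j (f j)) (by
    have h := Finset.prod_univ_sum (fun _ : Fin n => (Finset.univ : Finset ι))
      (fun j a => p j a)
    rw [Fintype.piFinset_univ] at h
    rw [← h]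
    refine Finset.prod_eq_one fun j _ => ?_
    exact (tsum_fintype (fun a => p j a)).symm.trans (p j).tsum_coe)

/-! ### AdaBoost on a reservoir of `m` labelled points, with resampling -/

/-- The memory of the algorithm: the weight of every point of the reservoir, the function
`x ↦ ∑ t, α t * h t x` and the number `∑ t, α t`, over the rounds so far. -/
structure State (X : Type*) (m : ℕ) where
  weight : Fin m → ℝ
  score : X → ℝ
  total : ℝ

/-- All weights are equal before the first round. -/
def State.init (X : Type*) (m : ℕ) : State X m := ⟨fun _ => 1, fun _ => 0, 0⟩

/-- The weighted majority vote of the weak hypotheses so far. -/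
def State.vote {X : Type*} {m : ℕ} (s : State X m) : X → Bool :=
  fun x => decide ((1 / 2) * s.total ≤ s.score x)

/-- The relative weight of the points of the reservoir that `h` misclassifies. -/
def weightedError {X : Type*} {m : ℕ} (x : Fin m → X) (y : Fin m → Bool) (w : Fin m → ℝ)
    (h : X → Bool) : ℝ :=
  (∑ a, if h (x a) = y a then 0 else w a) / ∑ a, w a

/-- The AdaBoost update after a weak hypothesis `h` of weighted error `e`: with
`β = e / (1 - e)`, the weights of the correctly classified points are multiplied by `β`, and `h`
gets a vote of weight `log (1 / β)`. -/
def State.update {X : Type*} {m : ℕ} (x : Fin m → X) (y : Fin m → Bool) (s : State X m)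
    (h : X → Bool) (e : ℝ) : State X m where
  weight a := if h (x a) = y a then s.weight a * (e / (1 - e)) else s.weight a
  score z := s.score z + Real.log (1 / (e / (1 - e))) * (if h z then 1 else 0)
  total := s.total + Real.log (1 / (e / (1 - e)))

/-- Up to `T` further rounds of AdaBoost on the reservoir `x` with labels `y`, from the state `s`;
the law of the final classifier. In each round `resample` draws `n` points of the reservoir
(with repetitions) according to the current weights, the weak learner `A` is run on them, and the
weights are updated. If the weak hypothesis makes no error on the reservoir (its vote would have
infinite weight) it is returned; if it is no better than a coin, boosting stops. -/
def boost {X : Type*} {m n : ℕ} (resample : (Fin m → ℝ) → PMF (Fin n → Fin m))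
    (A : (Fin n → X × Bool) → X → Bool) (x : Fin m → X) (y : Fin m → Bool) :
    ℕ → State X m → PMF (X → Bool)
  | 0, s => PMF.pure s.vote
  | T + 1, s => (resample s.weight).bind fun σ =>
      let h := A fun j => (x (σ j), y (σ j))
      let e := weightedError x y s.weight h
      if e = 0 then PMF.pure h
      else if 1 / 2 ≤ e then PMF.pure s.vote
      else boost resample A x y T (s.update x y h e)

/-- Centralized resampling: `n` independent points of the reservoir, proportionally to the
weights. -/
def centralResample {m : ℕ} [NeZero m] (n : ℕ) (w : Fin m → ℝ) : PMF (Fin n → Fin m) :=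
  indepDraws fun _ => draw w

/-- Distributed resampling. The reservoir `S i` of player `i` consists of the points `a` with
`owner a = i`. Pre-sampling: the center makes `n` multinomial draws of a player, proportionally to
the total weights of the reservoirs, to determine how many points to request from whom.
Sampling: every requested point is drawn by its player from the player's own reservoir,
independently (with replacement) and proportionally to the weights there. -/
def distResample {m k : ℕ} [NeZero m] [NeZero k] (owner : Fin m → Fin k) (n : ℕ)
    (w : Fin m → ℝ) : PMF (Fin n → Fin m) :=
  (indepDraws fun _ : Fin n => draw fun i : Fin k => ∑ a, if owner a = i then w a else 0).bind
    fun q => indepDraws fun j => draw fun a => if owner a = q j then w a else 0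

/-! ### Probability of success and sample complexity -/

/-- The uniform mixture of the players' distributions. -/
def mixture {X : Type*} [MeasurableSpace X] {k : ℕ} (D : Fin k → Measure X) : Measure X :=
  (k : ℝ≥0∞)⁻¹ • ∑ i, D i

/-- Probability that `T` rounds of AdaBoost, on a reservoir of `m` points drawn from `μ` and
labelled by `c`, with `n` points per round, return a classifier of error less than `ε` on `μ`. -/
def adaBoostSuccess {X : Type*} [MeasurableSpace X] {n : ℕ} (A : (Fin n → X × Bool) → X → Bool)
    (T m : ℕ) [NeZero m] (ε : ℝ) (μ : Measure X) (c : X → Bool) : ℝ≥0∞ :=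
  ∫⁻ x, (boost (centralResample n) A x (fun a => c (x a)) T (State.init X m)).toOuterMeasure
    {f | μ {z | f z ≠ c z} < ENNReal.ofReal ε} ∂(Measure.pi fun _ : Fin m => μ)

/-- Probability that Distributed Boosting with preprocessing returns a classifier of error less
than `ε` on the uniform mixture of the `k` players. Preprocessing: the center makes `m` uniform
multinomial draws of a player; player `i` fills a reservoir with as many points from `D i`,
labelled by `c`, as `i` has been drawn. The reservoirs have `m` points in total. -/
def distBoostSuccess {X : Type*} [MeasurableSpace X] {n : ℕ}
    (A : (Fin n → X × Bool) → X → Bool) (T m : ℕ) [NeZero m] {k : ℕ} [NeZero k] (ε : ℝ)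
    (D : Fin k → Measure X) (c : X → Bool) : ℝ≥0∞ :=
  ∑ owner : Fin m → Fin k,
    (indepDraws fun _ : Fin m => PMF.uniformOfFintype (Fin k)) owner *
      ∫⁻ x, (boost (distResample owner n) A x (fun a => c (x a)) T
          (State.init X m)).toOuterMeasure
        {f | mixture D {z | f z ≠ c z} < ENNReal.ofReal ε}
        ∂(Measure.pi fun a => D (owner a))

/-- The sample complexity of AdaBoost: the least `m ≥ 1` such that every reservoir size from `m`
on gives error less than `ε` with probability at least `1 - δ`, for every distribution and every
target in `H`; it is `⊤` if there is none. -/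
def adaBoostSampleComplexity {X : Type*} [MeasurableSpace X] (H : Set (X → Bool)) {n : ℕ}
    (A : (Fin n → X × Bool) → X → Bool) (T : ℕ) (ε δ : ℝ) : ℕ∞ :=
  ⨅ (m : ℕ) (_ : 1 ≤ m ∧ ∀ (m' : ℕ) [NeZero m'], m ≤ m' →
    ∀ μ : Measure X, IsProbabilityMeasure μ → ∀ c ∈ H,
      ENNReal.ofReal (1 - δ) ≤ adaBoostSuccess A T m' ε μ c), (m : ℕ∞)

/-- The sample complexity of Distributed Boosting with `k` players: the least total size `m ≥ 1`
of the reservoirs such that every total size from `m` on gives error less than `ε` on the mixture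
with probability at least `1 - δ`, for all distributions of the players and every target in `H`;
it is `⊤` if there is none. -/
def distBoostSampleComplexity {X : Type*} [MeasurableSpace X] (H : Set (X → Bool)) {n : ℕ}
    (A : (Fin n → X × Bool) → X → Bool) (T k : ℕ) [NeZero k] (ε δ : ℝ) : ℕ∞ :=
  ⨅ (m : ℕ) (_ : 1 ≤ m ∧ ∀ (m' : ℕ) [NeZero m'], m ≤ m' →
    ∀ D : Fin k → Measure X, (∀ i, IsProbabilityMeasure (D i)) → ∀ c ∈ H,
      ENNReal.ofReal (1 - δ) ≤ distBoostSuccess A T m' ε D c), (m : ℕ∞)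

/-- On every sample that some member of `H` labels correctly, `A` returns a member of `H` that
labels the sample correctly. -/
def IsConsistentLearner {X : Type*} (H : Set (X → Bool)) {n : ℕ}
    (A : (Fin n → X × Bool) → X → Bool) : Prop :=
  ∀ z : Fin n → X × Bool, (∃ c ∈ H, ∀ j, c (z j).1 = (z j).2) →
    A z ∈ H ∧ ∀ j, A z (z j).1 = (z j).2

end DistBoost

end

namespace DistBoost

/-! ### Traces of a class on a finite family of points -/

/-! The equality of the two sample complexities is an identity of laws. A product of uniform
mixtures is the average, over all assignments of sample positions to players, of products of the
players' distributions, so preprocessing yields `m` i.i.d. points of the mixture. Choosing a player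
by reservoir weight and then a point inside that reservoir is the same as choosing a point by
weight. Hence distributed boosting succeeds exactly as often as AdaBoost on the mixture; conversely
every `μ` is the mixture of `k` copies of itself.

The upper bound for AdaBoost excludes two events of probability at most `δ / 2`. In training, an
exponential potential dominates the number of errors and is at least halved by each round of
weighted error at most `1 / 16`. A union bound over the rounds, each a PAC statement for the weak
learner under the current weights, leaves at most `m / 2 ^ T ≤ ε m / 8` errors. In generalization,
no possible output may have so few training errors and yet true error at least `ε`.

Both the PAC statement and generalization come from `measure_low_empirical_error_le`, a
double-sample argument with an exponential weight whose average under exchanges of sample and ghost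
points is bounded. It concerns a countable family of jointly measurable learners, not a supremum
over the class, so no regularity of the class of majorities is needed. Boosting fits: once the
resampled indices are fixed it is a deterministic measurable learner, and there are finitely many
index lists.

The growth function of the majorities is at most the `T`-th power of that of `H` times that of
half-spaces in dimension `T`; this gives finiteness and the explicit bound on `d_boost`. -/

open Classical in
/-- The restrictions of the members of `G` to the finite family of points `u`. -/
noncomputable def traces {X ι : Type*} [Fintype ι] (G : Set (X → Bool)) (u : ι → X) :
    Finset (ι → Bool) :=
  Finset.univ.filter fun τ => ∃ f ∈ G, ∀ j, τ j = f (u j)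

theorem mem_traces {X ι : Type*} [Fintype ι] {G : Set (X → Bool)} {u : ι → X} {τ : ι → Bool} :
    τ ∈ traces G u ↔ ∃ f ∈ G, ∀ j, τ j = f (u j) := by
  simp [traces]

theorem Shatters.card_le {X : Type*} {H : Set (X → Bool)} {d : ℕ} (hd : vcDim H ≤ d)
    {s : Finset X} (hs : Shatters H s) : s.card ≤ d := by
  have : (s.card : ℕ∞) ≤ vcDim H :=
    le_iSup₂ (f := fun (s : Finset X) (_ : Shatters H s) => (s.card : ℕ∞)) s hs
  exact_mod_cast this.trans hd

/-- Each term with `k ≤ d` gains from the factor `r ^ (k - d) ≥ 1`, after which the binomial theorem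
applies. Keeping `r` free lets each use trade the price `(1 / r) ^ d` against a growth rate `r` as
small as required, with no condition relating `M` and `d`. -/
theorem sum_choose_le (d M : ℕ) {r : ℝ} (h0 : 0 < r) (h1 : r ≤ 1) :
    ((∑ k ∈ Finset.Iic d, M.choose k : ℕ) : ℝ) ≤ (1 / r) ^ d * (1 + r) ^ M := by
  have hM : (1 + r) ^ M = ∑ k ∈ Finset.range (M + 1), r ^ k * M.choose k := by
    rw [add_comm, add_pow]; simp
  have h2 : ∀ k ∈ Finset.Iic d, (M.choose k : ℝ) ≤ (1 / r) ^ d * (r ^ k * M.choose k) := by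
    intro k hk
    have hk' : k ≤ d := by simpa using hk
    have : 1 ≤ (1 / r) ^ d * r ^ k := by
      rw [one_div, inv_pow, ← div_eq_inv_mul, one_le_div (by positivity)]
      exact pow_le_pow_of_le_one h0.le h1 hk'
    nlinarith [Nat.cast_nonneg (α := ℝ) (M.choose k)]
  push_cast
  refine (Finset.sum_le_sum h2).trans ?_
  rw [← Finset.mul_sum, hM]
  refine mul_le_mul_of_nonneg_left ?_ (by positivity)
  have h3 : ∑ k ∈ Finset.Iic d, r ^ k * (M.choose k : ℝ)
      = ∑ k ∈ (Finset.Iic d).filter (· < M + 1), r ^ k * (M.choose k : ℝ) := by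
    rw [Finset.sum_filter]
    refine Finset.sum_congr rfl fun k _ => ?_
    split_ifs with h
    · rfl
    · rw [Nat.choose_eq_zero_of_lt (by omega)]; simp
  rw [h3]
  refine Finset.sum_le_sum_of_subset_of_nonneg ?_ fun _ _ _ => by positivity
  intro k hk
  simpa using (Finset.mem_filter.1 hk).2

open Classical in
/-- The **Sauer-Shelah lemma** for traces. -/
theorem card_traces_le_sum {X ι : Type*} [Fintype ι] {G : Set (X → Bool)} {d : ℕ}
    (hd : vcDim G ≤ d) (u : ι → X) :
    (traces G u).card ≤ ∑ k ∈ Finset.Iic d, (Fintype.card ι).choose k := by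
  let φ : (ι → Bool) → Finset ι := fun τ => Finset.univ.filter fun j => τ j = true
  have hφ : Function.Injective φ := by
    intro τ τ' h
    funext j
    have : j ∈ φ τ ↔ j ∈ φ τ' := by rw [h]
    simp only [φ, Finset.mem_filter, Finset.mem_univ, true_and] at this
    exact Bool.eq_iff_iff.2 this
  set 𝒜 := (traces G u).image φ with h𝒜
  have hcard : 𝒜.card = (traces G u).card := Finset.card_image_of_injective _ hφ
  have hvc : 𝒜.vcDim ≤ d := by
    refine Finset.sup_le fun s hs => ?_
    rw [Finset.mem_shatterer] at hs
    have key : ∀ g : ι → Bool, ∃ f ∈ G, ∀ j ∈ s, f (u j) = g j := by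
      intro g
      obtain ⟨t, ht, hst⟩ := hs (Finset.filter_subset (fun j => g j = true) s)
      obtain ⟨τ, hτ, rfl⟩ := Finset.mem_image.1 ht
      obtain ⟨f, hf, hfu⟩ := mem_traces.1 hτ
      refine ⟨f, hf, fun j hj => ?_⟩
      have := Finset.ext_iff.1 hst j
      simp only [Finset.mem_inter, hj, φ, Finset.mem_filter, Finset.mem_univ, true_and] at this
      rw [← hfu j]
      exact Bool.eq_iff_iff.2 this
    have hinj : Set.InjOn u s := by
      intro i hi j hj hij
      by_contra hne
      obtain ⟨f, -, hf⟩ := key fun a => decide (a = i)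
      have h1 := hf i hi
      have h2 := hf j hj
      rw [hij] at h1
      rw [h1] at h2
      simp [Ne.symm hne] at h2
    have hsh : Shatters G (s.image u) := by
      intro g
      obtain ⟨f, hf, hfg⟩ := key (g ∘ u)
      exact ⟨f, hf, by simpa using hfg⟩
    have := hsh.card_le hd
    rwa [Finset.card_image_of_injOn hinj] at this
  calc (traces G u).card = 𝒜.card := hcard.symm
    _ ≤ 𝒜.shatterer.card := Finset.card_le_card_shatterer _
    _ ≤ ∑ k ∈ Finset.Iic 𝒜.vcDim, (Fintype.card ι).choose k := Finset.card_shatterer_le_sum_vcDim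
    _ ≤ _ := Finset.sum_le_sum_of_subset (Finset.Iic_subset_Iic.2 hvc)

/-! ### The VC dimension of weighted majority votes -/

/-- Weighted majority votes as functions of the vector of votes. -/
def majorities (T : ℕ) : Set ((Fin T → ℝ) → Bool) :=
  {f | ∃ α : Fin T → ℝ, ∀ v, f v = true ↔ (1 / 2) * ∑ t, α t ≤ ∑ t, α t * v t}

/-- In the coordinates `v - 1 / 2` a majority is a homogeneous half-space `⟨α, v - 1 / 2⟩ ≥ 0` of `ℝ
^ T`. More than `T` points satisfy a linear relation, and the labelling by the signs of its
coefficients makes every term nonnegative and one positive, although the sum is zero. -/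
theorem vcDim_majorities_le (T : ℕ) : vcDim (majorities T) ≤ T := by
  classical
  refine iSup₂_le fun s hs => ?_
  by_contra hlt
  have hlt' : T < s.card := by exact_mod_cast not_le.1 hlt
  -- A negative coefficient is demanded because only the label `false` gives a strict inequality;
  -- the label `true` gives just `≥ 0`.
  obtain ⟨c, hc, j, hj⟩ : ∃ c : s → ℝ, ∑ v, c v • (fun t => v.1 t - 1 / 2 : Fin T → ℝ) = 0 ∧
      ∃ v, c v < 0 := by
    have hdep : ¬ LinearIndependent ℝ fun v : s => (fun t => v.1 t - 1 / 2 : Fin T → ℝ) := by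
      intro h
      have := h.fintype_card_le_finrank
      simp at this
      omega
    obtain ⟨g, hg, i, hi⟩ := Fintype.not_linearIndependent_iff.1 hdep
    rcases lt_or_gt_of_ne hi with h | h
    · exact ⟨g, hg, i, h⟩
    · refine ⟨-g, ?_, i, by simpa using h⟩
      simpa using hg
  obtain ⟨f, ⟨α, hα⟩, hf⟩ := hs fun v => if h : v ∈ s then decide (0 ≤ c ⟨v, h⟩) else true
  have hlin : ∑ v : s, c v * ∑ t, α t * (v.1 t - 1 / 2) = 0 := by
    have : ∀ t, ∑ v : s, c v * (v.1 t - 1 / 2) = 0 := fun t => by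
      simpa using congrFun hc t
    simp_rw [Finset.mul_sum]
    rw [Finset.sum_comm]
    refine Finset.sum_eq_zero fun t _ => ?_
    rw [← mul_zero (α t), ← this t, Finset.mul_sum]
    exact Finset.sum_congr rfl fun _ _ => by ring
  have hsplit : ∀ v : Fin T → ℝ, ∑ t, α t * (v t - 1 / 2)
      = ∑ t, α t * v t - (1 / 2) * ∑ t, α t := fun v => by
    rw [Finset.mul_sum, ← Finset.sum_sub_distrib]
    exact Finset.sum_congr rfl fun _ _ => by ring
  have hpos : ∀ v : s, 0 ≤ c v * ∑ t, α t * (v.1 t - 1 / 2) ∧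
      (c v < 0 → 0 < c v * ∑ t, α t * (v.1 t - 1 / 2)) := by
    intro v
    have h1 := hf v.1 v.2
    have h2 := hα v.1
    rw [h1] at h2
    simp only [v.2, dite_true, decide_eq_true_eq, Subtype.coe_eta] at h2
    rw [hsplit]
    constructor
    · rcases le_or_gt 0 (c v) with h | h
      · exact mul_nonneg h (sub_nonneg.2 (h2.1 h))
      · exact mul_nonneg_of_nonpos_of_nonpos h.le
          (by have := mt h2.2 (not_le.2 h); linarith)
    · intro h
      exact mul_pos_of_neg_of_neg h (by have := mt h2.2 (not_le.2 h); linarith)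
  have := Finset.sum_pos' (fun v (_ : v ∈ Finset.univ) => (hpos v).1)
    ⟨j, Finset.mem_univ _, (hpos j).2 hj⟩
  linarith

-- The `T` voters have at most `a ^ T` joint traces. Once these are fixed, each point becomes a
-- known vector of votes, and only the choice of the coefficients remains, which is a trace of
-- `majorities T`.
open Classical in
theorem card_traces_boostedClass_le {X ι : Type*} [Fintype ι] {H : Set (X → Bool)} {T : ℕ}
    {a b : ℕ} (u : ι → X) (ha : (traces H u).card ≤ a)
    (hb : ∀ v : ι → Fin T → ℝ, (traces (majorities T) v).card ≤ b) :
    (traces (boostedClass H T) u).card ≤ a ^ T * b := by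
  let vec : (Fin T → ι → Bool) → ι → Fin T → ℝ := fun g j t => if g t j then 1 else 0
  have hsub : traces (boostedClass H T) u ⊆
      (Fintype.piFinset fun _ : Fin T => traces H u).biUnion
        fun g => traces (majorities T) (vec g) := by
    intro τ hτ
    obtain ⟨f, ⟨h, α, hh, -, hf⟩, hτf⟩ := mem_traces.1 hτ
    refine Finset.mem_biUnion.2 ⟨fun t j => h t (u j), ?_, ?_⟩
    · exact Fintype.mem_piFinset.2 fun t => mem_traces.2 ⟨h t, hh t, fun _ => rfl⟩
    · refine mem_traces.2 ⟨fun v => decide ((1 / 2) * ∑ t, α t ≤ ∑ t, α t * v t),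
        ⟨α, fun v => by simp⟩, fun j => ?_⟩
      rw [hτf j, Bool.eq_iff_iff, hf (u j)]
      simp [vec]
  refine (Finset.card_le_card hsub).trans ((Finset.card_biUnion_le_card_mul _ _ b
    fun g _ => hb _).trans ?_)
  rw [Fintype.card_piFinset_const]
  gcongr

/-- A shattered set has all `2 ^ N` traces. -/
theorem Shatters.two_pow_le {X : Type*} {G : Set (X → Bool)} {s : Finset X} (hs : Shatters G s) :
    2 ^ s.card ≤ (traces G ((↑) : s → X)).card := by
  classical
  have : traces G ((↑) : s → X) = Finset.univ := by
    refine Finset.eq_univ_iff_forall.2 fun τ => mem_traces.2 ?_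
    obtain ⟨f, hf, hfs⟩ := hs fun x => if h : x ∈ s then τ ⟨x, h⟩ else true
    exact ⟨f, hf, fun j => by simp [hfs j.1 j.2]⟩
  rw [this]
  simp

theorem vcDim_boostedClass_le {X : Type*} {H : Set (X → Bool)} {d T : ℕ} (hd : vcDim H ≤ d)
    (hT : 1 ≤ T) {s : Finset X} (hs : Shatters (boostedClass H T) s) :
    (s.card : ℝ) ≤ 6 * (d * T * Real.log (4 * T) + T * Real.log 4) := by
  have hT' : (1 : ℝ) ≤ T := by exact_mod_cast hT
  set N : ℕ := s.card with hN
  have hcard : Fintype.card s = N := by simp [hN]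
  have h1 : (2 : ℝ) ^ N ≤ ((∑ k ∈ Finset.Iic d, N.choose k : ℕ) : ℝ) ^ T *
      ((∑ k ∈ Finset.Iic T, N.choose k : ℕ) : ℝ) := by
    have := hs.two_pow_le.trans (card_traces_boostedClass_le _ (card_traces_le_sum hd _)
      (fun v => card_traces_le_sum (vcDim_majorities_le T) v))
    rw [hcard] at this
    exact_mod_cast this
  -- With `r = 1 / (4 T)` for the `T` voters and `r = 1 / 4` for the half-space, the factors growing
  -- with `N` contribute at most `exp (N / 4)` each. Their product `exp (N / 2)` stays below `2 ^
  -- N`, and `log 2 - 1 / 2 > 1 / 6` produces the factor 6.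
  have h2 : (2 : ℝ) ^ N ≤ ((1 / (1 / (4 * T))) ^ d * (1 + 1 / (4 * T)) ^ N : ℝ) ^ T *
      ((1 / (1 / 4)) ^ T * (1 + 1 / 4) ^ N : ℝ) := by
    refine h1.trans ?_
    gcongr
    · exact sum_choose_le d N (by positivity) (by rw [div_le_one (by positivity)]; linarith)
    · exact sum_choose_le T N (by norm_num) (by norm_num)
  have h3 : (2 : ℝ) ^ N ≤ Real.exp (d * T * Real.log (4 * T) + T * Real.log 4 + N / 2) := by
    refine h2.trans ?_
    have e1 : (1 / (1 / (4 * T)) : ℝ) = Real.exp (Real.log (4 * T)) := by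
      rw [Real.exp_log (by positivity)]; simp
    have e2 : (1 + 1 / (4 * T) : ℝ) ≤ Real.exp (1 / (4 * T)) := by
      linarith [Real.add_one_le_exp (1 / (4 * T) : ℝ)]
    have e3 : (1 / (1 / 4) : ℝ) = Real.exp (Real.log 4) := by
      rw [Real.exp_log (by norm_num)]; norm_num
    have e4 : (1 + 1 / 4 : ℝ) ≤ Real.exp (1 / 4) := by
      linarith [Real.add_one_le_exp (1 / 4 : ℝ)]
    calc _ ≤ (Real.exp (Real.log (4 * T)) ^ d * Real.exp (1 / (4 * T)) ^ N) ^ T *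
        (Real.exp (Real.log 4) ^ T * Real.exp (1 / 4) ^ N) := by
          rw [e1, e3]; gcongr
      _ = _ := by
        simp only [← Real.exp_nat_mul, ← Real.exp_add]
        congr 1
        field_simp
        ring
  have h4 : (N : ℝ) * Real.log 2 ≤ d * T * Real.log (4 * T) + T * Real.log 4 + N / 2 := by
    have := Real.log_le_log (by positivity) h3
    rwa [Real.log_pow, Real.log_exp] at this
  have := Real.log_two_gt_d9
  have hN0 : (0 : ℝ) ≤ N := Nat.cast_nonneg _
  nlinarith

/-! ### A double-sample bound for measurable learners -/

/-- The weight of an error `b` on the sample and `b'` on the ghost sample. -/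
def pairWeight (b b' : Bool) : ℕ := (if b then 1 else 2) * (if b' then 3 else 2)

/-- The weights are 4 without errors, 6 for an error on the ghost only, 2 for an error on the sample
only, and 3 for both. Exchanging the two points therefore averages to at most 4. -/
theorem pairWeight_add_le (b b' : Bool) : pairWeight b b' + pairWeight b' b ≤ 8 := by
  cases b <;> cases b' <;> simp [pairWeight]

theorem lintegral_pi_prod {X : Type*} [MeasurableSpace X] {N : ℕ} (μ : Measure X)
    [IsProbabilityMeasure μ] {g : X → ℝ≥0∞} (hg : Measurable g) :
    ∫⁻ x, ∏ a, g (x a) ∂(Measure.pi fun _ : Fin N => μ) = (∫⁻ z, g z ∂μ) ^ N := by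
  have h := ProbabilityTheory.lintegral_prod_eq_prod_lintegral_of_indepFun
    (μ := Measure.pi fun _ : Fin N => μ) Finset.univ (fun a x => g (x a))
    (ProbabilityTheory.iIndepFun_pi fun _ => hg.aemeasurable)
    (fun a => hg.comp (measurable_pi_apply a))
  rw [h]
  have : ∀ a : Fin N, ∫⁻ x, g (x a) ∂(Measure.pi fun _ : Fin N => μ) = ∫⁻ z, g z ∂μ := fun a =>
    (measurePreserving_eval (fun _ : Fin N => μ) a).lintegral_comp hg
  simp [this]

/-- Exchange of some of the pairs of a double sample. -/
def swapPairs {X : Type*} {N : ℕ} (s : Fin N → Bool) (z : Fin N → X × X) : Fin N → X × X :=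
  fun a => if s a then (z a).swap else z a

theorem measurePreserving_swapPairs {X : Type*} [MeasurableSpace X] {N : ℕ} (μ : Measure X)
    [IsProbabilityMeasure μ] (s : Fin N → Bool) :
    MeasurePreserving (swapPairs s) (Measure.pi fun _ : Fin N => μ.prod μ)
      (Measure.pi fun _ : Fin N => μ.prod μ) := by
  refine measurePreserving_pi (f := fun a (p : X × X) => if s a then p.swap else p)
    (fun _ => μ.prod μ) (fun _ => μ.prod μ) fun a => ?_
  cases s a
  · exact MeasurePreserving.id (μ.prod μ)
  · simpa using Measure.measurePreserving_swap (μ := μ) (ν := μ)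

/-- The product of the weights of the pairs of a double sample `z`, for the classifier `f` and
the target `c`. -/
def doubleWeight {X : Type*} {N : ℕ} (c f : X → Bool) (z : Fin N → X × X) : ℕ :=
  ∏ a, pairWeight (f (z a).1 != c (z a).1) (f (z a).2 != c (z a).2)

/-- The two halves of a double sample as one family of points. -/
def doublePoints {X : Type*} {N : ℕ} (z : Fin N → X × X) : Fin N × Bool → X :=
  fun p => if p.2 then (z p.1).2 else (z p.1).1

/-- For a fixed trace the sum over exchanges factorizes over the pairs, each contributing at most 8.
The classifier may depend on the exchange `s`, as it is learned from the exchanged first half. -/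
theorem sum_sup_doubleWeight_le {X : Type*} {N Γ : ℕ} {G : Set (X → Bool)} (c : X → Bool)
    (z : Fin N → X × X) (hΓ : (traces G (doublePoints z)).card ≤ Γ) {κ : Type*}
    (F : κ → (Fin N → Bool) → X → Bool) (hF : ∀ i s, F i s ∈ G) :
    ∑ s, ⨆ i, (doubleWeight c (F i s) (swapPairs s z) : ℝ≥0∞) ≤ Γ * 8 ^ N := by
  let e : (Fin N × Bool → Bool) → Fin N → Bool → Bool := fun τ a b =>
    τ (a, b) != c (doublePoints z (a, b))
  let W : (Fin N × Bool → Bool) → (Fin N → Bool) → ℕ := fun τ s =>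
    ∏ a, pairWeight (e τ a (s a)) (e τ a (!s a))
  have h1 : ∀ i s, doubleWeight c (F i s) (swapPairs s z)
      = W (fun p => F i s (doublePoints z p)) s := by
    intro i s
    refine Finset.prod_congr rfl fun a _ => ?_
    cases hs : s a <;> simp [swapPairs, e, doublePoints, hs]
  -- The supremum is replaced by a sum over all traces on the double sample, a set independent of
  -- `s`, so that the sums can be interchanged.
  have h2 : ∀ s, ⨆ i, (doubleWeight c (F i s) (swapPairs s z) : ℝ≥0∞)
      ≤ ∑ τ ∈ traces G (doublePoints z), (W τ s : ℝ≥0∞) := by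
    intro s
    refine iSup_le fun i => ?_
    rw [h1]
    have hmem : (fun p => F i s (doublePoints z p)) ∈ traces G (doublePoints z) :=
      mem_traces.2 ⟨F i s, hF i s, fun _ => rfl⟩
    generalize (fun p => F i s (doublePoints z p)) = τ at hmem
    exact Finset.single_le_sum_of_canonicallyOrdered (f := fun τ => (W τ s : ℝ≥0∞)) hmem
  have h3 : ∀ τ, ∑ s, W τ s ≤ 8 ^ N := by
    intro τ
    have := Finset.prod_univ_sum (fun _ : Fin N => (Finset.univ : Finset Bool))
      (fun a b => pairWeight (e τ a b) (e τ a (!b)))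
    rw [Fintype.piFinset_univ] at this
    rw [← this]
    calc _ ≤ ∏ _a : Fin N, 8 := Finset.prod_le_prod' fun a _ => by
          simpa [add_comm] using pairWeight_add_le (e τ a true) (e τ a false)
      _ = _ := by simp
  calc _ ≤ ∑ s, ∑ τ ∈ traces G (doublePoints z), (W τ s : ℝ≥0∞) :=
        Finset.sum_le_sum fun s _ => h2 s
    _ = ∑ τ ∈ traces G (doublePoints z), ((∑ s, W τ s : ℕ) : ℝ≥0∞) := by
        rw [Finset.sum_comm]; push_cast; rfl
    _ ≤ ∑ τ ∈ traces G (doublePoints z), (8 : ℝ≥0∞) ^ N :=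
        Finset.sum_le_sum fun τ _ => by exact_mod_cast h3 τ
    _ ≤ _ := by
        rw [Finset.sum_const, nsmul_eq_mul]
        gcongr

theorem measurable_pairWeight_comp {Y : Type*} [MeasurableSpace Y] {b b' : Y → Bool}
    (hb : Measurable b) (hb' : Measurable b') :
    Measurable fun y => (pairWeight (b y) (b' y) : ℝ≥0∞) :=
  (Measurable.of_discrete (f := fun p : Bool × Bool => (pairWeight p.1 p.2 : ℝ≥0∞))).comp
    (hb.prodMk hb')

theorem measurable_bne_comp {Y : Type*} [MeasurableSpace Y] {b b' : Y → Bool}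
    (hb : Measurable b) (hb' : Measurable b') : Measurable fun y => (b y != b' y) :=
  (Measurable.of_discrete (f := fun p : Bool × Bool => (p.1 != p.2))).comp (hb.prodMk hb')

/-- The number of errors of `f` on the sample `x`, labelled by `c`. -/
def errCount {X : Type*} {N : ℕ} (c f : X → Bool) (x : Fin N → X) : ℕ :=
  (Finset.univ.filter fun a => f (x a) ≠ c (x a)).card

/-- The classifier is fixed before the ghost sample is drawn, so the ghost factors are independent,
each of mean `2 + μ {f ≠ c}`. The weight thus turns few sample errors and large true error into a
large integral. -/
theorem lintegral_ghost {X : Type*} [MeasurableSpace X] {N : ℕ} (μ : Measure X)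
    [IsProbabilityMeasure μ] {c f : X → Bool} (hc : Measurable c) (hf : Measurable f)
    (x : Fin N → X) :
    ∫⁻ x', (doubleWeight c f (fun a => (x a, x' a)) : ℝ≥0∞) ∂(Measure.pi fun _ : Fin N => μ)
      = 2 ^ (N - errCount c f x) * (2 + μ {z | f z ≠ c z}) ^ N := by
  have hm : Measurable fun z => (if (f z != c z) then 3 else 2 : ℝ≥0∞) :=
    (Measurable.of_discrete (f := fun b : Bool => (if b then 3 else 2 : ℝ≥0∞))).comp
      (measurable_bne_comp hf hc)
  have hset : MeasurableSet {z | f z ≠ c z} := (measurableSet_eq_fun hf hc).compl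
  have h1 : ∀ x' : Fin N → X, (doubleWeight c f (fun a => (x a, x' a)) : ℝ≥0∞)
      = 2 ^ (N - errCount c f x) * ∏ a, (if (f (x' a) != c (x' a)) then 3 else 2 : ℝ≥0∞) := by
    intro x'
    simp only [doubleWeight, pairWeight, Finset.prod_mul_distrib, Nat.cast_mul]
    congr 1
    · have : ∏ a, (if (f (x a) != c (x a)) then 1 else 2 : ℕ) = 2 ^ (N - errCount c f x) := by
        rw [Finset.prod_ite, Finset.prod_const_one, one_mul, Finset.prod_const]
        congr 1
        have := Finset.card_filter_add_card_filter_not (s := (Finset.univ : Finset (Fin N)))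
          (fun a => f (x a) ≠ c (x a))
        simp only [errCount, bne_iff_ne, Finset.card_univ, Fintype.card_fin] at this ⊢
        omega
      rw [this]; push_cast; rfl
    · push_cast
      refine Finset.prod_congr rfl fun a _ => ?_
      split_ifs <;> simp
  have hprod : Measurable fun x' : Fin N → X =>
      ∏ a, (if (f (x' a) != c (x' a)) then 3 else 2 : ℝ≥0∞) :=
    Finset.measurable_prod _ fun a _ => hm.comp (measurable_pi_apply a)
  simp_rw [h1]
  rw [lintegral_const_mul _ hprod, lintegral_pi_prod μ hm]
  congr 2
  have h2 : ∀ z, (if (f z != c z) then 3 else 2 : ℝ≥0∞)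
      = 2 + {z | f z ≠ c z}.indicator (fun _ => 1) z := by
    intro z
    by_cases h : f z = c z
    · simp [h]
    · simp [h]; norm_num
  simp_rw [h2]
  rw [lintegral_add_left measurable_const, lintegral_indicator_const hset]
  simp

/-- **Double-sample bound**: the probability that one of countably many measurable learners with
values in `G` makes at most `a` errors on the sample but has error at least `ε`. -/
theorem measure_low_empirical_error_le {X : Type*} [MeasurableSpace X] {N Γ : ℕ} (μ : Measure X)
    [IsProbabilityMeasure μ] {G : Set (X → Bool)}
    (hΓ : ∀ u : Fin N × Bool → X, (traces G u).card ≤ Γ) {c : X → Bool} (hc : Measurable c)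
    {κ : Type*} [Countable κ] (F : κ → (Fin N → X) → X → Bool)
    (hF : ∀ i, Measurable fun p : (Fin N → X) × X => F i p.1 p.2) (hG : ∀ i x, F i x ∈ G)
    (a : ℕ) (ε : ℝ≥0∞) :
    2 ^ (N - a) * (2 + ε) ^ N * (Measure.pi fun _ : Fin N => μ)
      {x | ∃ i, errCount c (F i x) x ≤ a ∧ ε ≤ μ {z | F i x z ≠ c z}} ≤ Γ * 4 ^ N := by
  set P := Measure.pi fun _ : Fin N => μ with hP
  set Q := Measure.pi fun _ : Fin N => μ.prod μ with hQ
  let φ : κ → (Fin N → X × X) → ℝ≥0∞ := fun i z =>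
    (doubleWeight c (F i fun a => (z a).1) z : ℝ≥0∞)
  have hφ : ∀ i, Measurable (φ i) := by
    intro i
    have hfst : Measurable fun z : Fin N → X × X => fun a => (z a).1 := by fun_prop
    have : φ i = fun z => ∏ a, (pairWeight (F i (fun a => (z a).1) (z a).1 != c (z a).1)
        (F i (fun a => (z a).1) (z a).2 != c (z a).2) : ℝ≥0∞) := by
      funext z; simp [φ, doubleWeight]
    rw [this]
    refine Finset.measurable_prod _ fun a _ => measurable_pairWeight_comp ?_ ?_
    · exact measurable_bne_comp ((hF i).comp (hfst.prodMk
        (by fun_prop : Measurable fun z : Fin N → X × X => (z a).1)))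
        (hc.comp (by fun_prop))
    · exact measurable_bne_comp ((hF i).comp (hfst.prodMk
        (by fun_prop : Measurable fun z : Fin N → X × X => (z a).2)))
        (hc.comp (by fun_prop))
  let Φ : (Fin N → X × X) → ℝ≥0∞ := fun z => ⨆ i, φ i z
  have hΦ : Measurable Φ := Measurable.iSup hφ
  have hup : ∫⁻ z, Φ z ∂Q ≤ Γ * 4 ^ N := by
    -- The law of the double sample is invariant under exchanges, so the integral may be averaged
    -- over all `2 ^ N` of them.
    have hs : ∀ s : Fin N → Bool, ∫⁻ z, Φ (swapPairs s z) ∂Q = ∫⁻ z, Φ z ∂Q := fun s =>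
      (measurePreserving_swapPairs μ s).lintegral_comp hΦ
    have h1 : 2 ^ N * ∫⁻ z, Φ z ∂Q ≤ Γ * 8 ^ N := by
      calc 2 ^ N * ∫⁻ z, Φ z ∂Q = ∑ s : Fin N → Bool, ∫⁻ z, Φ (swapPairs s z) ∂Q := by
            simp [hs]
        _ = ∫⁻ z, ∑ s : Fin N → Bool, Φ (swapPairs s z) ∂Q :=
            (lintegral_finsetSum _ fun s _ =>
              hΦ.comp (measurePreserving_swapPairs μ s).measurable).symm
        _ ≤ ∫⁻ _, Γ * 8 ^ N ∂Q := lintegral_mono fun z =>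
            sum_sup_doubleWeight_le c z (hΓ _) (fun i s => F i fun a => (swapPairs s z a).1)
              fun i s => hG i _
        _ = Γ * 8 ^ N := by simp
    have h2 : (Γ : ℝ≥0∞) * 8 ^ N = 2 ^ N * (Γ * 4 ^ N) := by
      rw [show (8 : ℝ≥0∞) = 2 * 4 by norm_num, mul_pow]; ring
    rw [h2] at h1
    exact (ENNReal.mul_le_mul_iff_right (by simp) (by simp)).1 h1
  let J : (Fin N → X) × (Fin N → X) → Fin N → X × X := fun p a => (p.1 a, p.2 a)
  have hJ : MeasurePreserving J (P.prod P) Q :=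
    (measurePreserving_arrowProdEquivProdArrow X X (Fin N) (fun _ => μ) (fun _ => μ)).symm
  have hΦJ : Measurable fun p => Φ (J p) := hΦ.comp hJ.measurable
  let g : (Fin N → X) → ℝ≥0∞ := fun x => ∫⁻ x', Φ (J (x, x')) ∂P
  have hg : Measurable g := hΦJ.lintegral_prod_right
  have hgint : ∫⁻ x, g x ∂P ≤ Γ * 4 ^ N := by
    rw [← lintegral_prod _ hΦJ.aemeasurable, hJ.lintegral_comp hΦ]
    exact hup
  -- Markov's inequality for the measurable function `g`; the bad set only has to lie inside `{g ≥
  -- ...}` and need not be measurable itself.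
  refine le_trans ?_ ((mul_meas_ge_le_lintegral hg (2 ^ (N - a) * (2 + ε) ^ N)).trans hgint)
  refine mul_le_mul_right (measure_mono ?_) _
  rintro x ⟨i, hi, hε⟩
  show 2 ^ (N - a) * (2 + ε) ^ N ≤ ∫⁻ x', Φ (J (x, x')) ∂P
  have hfm : Measurable (F i x) := (hF i).comp measurable_prodMk_left
  calc _ ≤ 2 ^ (N - errCount c (F i x) x) * (2 + μ {z | F i x z ≠ c z}) ^ N := by
        gcongr
        norm_num
    _ = ∫⁻ x', φ i (J (x, x')) ∂P := (lintegral_ghost μ hc hfm x).symm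
    _ ≤ _ := lintegral_mono fun x' => le_iSup (fun i => φ i (J (x, x'))) i

/-! ### The possible outputs of boosting -/

/-- The output of boosting when the resampled indices in the successive rounds are `l`. -/
noncomputable def outcome {X : Type*} {m n : ℕ} (A : (Fin n → X × Bool) → X → Bool)
    (x : Fin m → X) (y : Fin m → Bool) : List (Fin n → Fin m) → State X m → X → Bool
  | [], s => s.vote
  | σ :: l, s =>
      let h := A fun j => (x (σ j), y (σ j))
      let e := weightedError x y s.weight h
      if e = 0 then h else if 1 / 2 ≤ e then s.vote
      else outcome A x y l (s.update x y h e)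

/-- Derandomization: the sample enters only through a deterministic map, indexed by a finite set of
lists that does not depend on the sample. -/
theorem exists_outcome_of_mem_support {X : Type*} {m n : ℕ}
    (resample : (Fin m → ℝ) → PMF (Fin n → Fin m)) (A : (Fin n → X × Bool) → X → Bool)
    (x : Fin m → X) (y : Fin m → Bool) (T : ℕ) (s : State X m) (f : X → Bool)
    (hf : f ∈ (boost resample A x y T s).support) :
    ∃ l : List (Fin n → Fin m), l.length = T ∧ outcome A x y l s = f := by
  induction T generalizing s with
  | zero =>
    rw [boost, PMF.mem_support_pure_iff] at hf
    exact ⟨[], rfl, hf.symm⟩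
  | succ T ih =>
    rw [boost, PMF.mem_support_bind_iff] at hf
    obtain ⟨σ, -, hσ⟩ := hf
    dsimp only at hσ
    split_ifs at hσ with h1 h2
    -- After an early stop the rest of the list is never read; it only pads the length to the number
    -- of rounds.
    · refine ⟨σ :: List.replicate T σ, by simp, ?_⟩
      rw [PMF.mem_support_pure_iff] at hσ
      simp [outcome, h1, hσ]
    · refine ⟨σ :: List.replicate T σ, by simp, ?_⟩
      rw [PMF.mem_support_pure_iff] at hσ
      simp only [outcome, h1, h2, if_true, if_false, hσ]
    · obtain ⟨l, hl, hlf⟩ := ih _ hσ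
      refine ⟨σ :: l, by simp [hl], ?_⟩
      simp only [outcome, h1, h2, if_false, hlf]

/-- `S` and `τ` are the score and the total weight of `t` weighted votes of members of `H`. -/
def IsVoteSum {X : Type*} (H : Set (X → Bool)) (t : ℕ) (S : X → ℝ) (τ : ℝ) : Prop :=
  ∃ (h : Fin t → X → Bool) (α : Fin t → ℝ), (∀ i, h i ∈ H) ∧ (∀ i, 0 ≤ α i) ∧
    (∀ z, S z = ∑ i, α i * (if h i z then 1 else 0)) ∧ τ = ∑ i, α i

theorem IsVoteSum.succ {X : Type*} {H : Set (X → Bool)} {t : ℕ} {S : X → ℝ} {τ : ℝ}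
    (hS : IsVoteSum H t S τ) {h : X → Bool} (hh : h ∈ H) {a : ℝ} (ha : 0 ≤ a) :
    IsVoteSum H (t + 1) (fun z => S z + a * (if h z then 1 else 0)) (τ + a) := by
  obtain ⟨g, α, hg, hα, hSg, hτ⟩ := hS
  refine ⟨Fin.snoc (α := fun _ => X → Bool) g h, Fin.snoc (α := fun _ => ℝ) α a, ?_, ?_, ?_, ?_⟩
  · intro i
    refine Fin.lastCases ?_ (fun i => ?_) i
    · simpa using hh
    · simpa using hg i
  · intro i
    refine Fin.lastCases ?_ (fun i => ?_) i
    · simpa using ha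
    · simpa using hα i
  · intro z
    rw [Fin.sum_univ_castSucc]
    simp [hSg]
  · rw [Fin.sum_univ_castSucc, hτ]
    simp

theorem IsVoteSum.add {X : Type*} {H : Set (X → Bool)} {t : ℕ} {S : X → ℝ} {τ : ℝ}
    (hS : IsVoteSum H t S τ) (hH : H.Nonempty) (r : ℕ) : IsVoteSum H (t + r) S τ := by
  obtain ⟨h, hh⟩ := hH
  induction r with
  | zero => exact hS
  | succ r ih =>
    have h1 := ih.succ hh le_rfl
    simp only [zero_mul, add_zero] at h1
    exact h1

theorem IsVoteSum.mem_boostedClass {X : Type*} {H : Set (X → Bool)} {t : ℕ} {S : X → ℝ} {τ : ℝ}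
    (hS : IsVoteSum H t S τ) : (fun z => decide ((1 / 2) * τ ≤ S z)) ∈ boostedClass H t := by
  obtain ⟨g, α, hg, hα, hSg, hτ⟩ := hS
  exact ⟨g, α, hg, hα, fun z => by rw [decide_eq_true_iff, hSg, hτ]⟩

theorem isVoteSum_zero {X : Type*} (H : Set (X → Bool)) : IsVoteSum H 0 (fun _ => 0) 0 :=
  ⟨fun _ _ => true, fun _ => 0, fun i => i.elim0, fun _ => le_rfl, by simp, by simp⟩

theorem mem_boostedClass_of_mem {X : Type*} {H : Set (X → Bool)} {h : X → Bool} (hh : h ∈ H)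
    (t : ℕ) : h ∈ boostedClass H (1 + t) := by
  have := (((isVoteSum_zero H).succ hh zero_le_one).add ⟨h, hh⟩ t).mem_boostedClass
  convert this using 1
  · funext z
    cases h z <;> norm_num

theorem weightedError_nonneg {X : Type*} {m : ℕ} (x : Fin m → X) (y : Fin m → Bool)
    {w : Fin m → ℝ} (hw : ∀ a, 0 < w a) (h : X → Bool) : 0 ≤ weightedError x y w h := by
  refine div_nonneg (Finset.sum_nonneg fun a _ => ?_) (Finset.sum_nonneg fun a _ => (hw a).le)
  split_ifs
  · exact le_rfl
  · exact (hw a).le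

theorem State.update_weight_pos {X : Type*} {m : ℕ} (x : Fin m → X) (y : Fin m → Bool)
    {s : State X m} (hs : ∀ a, 0 < s.weight a) (h : X → Bool) {e : ℝ} (he : 0 < e)
    (he' : e < 1 / 2) (a : Fin m) : 0 < (s.update x y h e).weight a := by
  have : 0 < e / (1 - e) := div_pos he (by linarith)
  simp only [State.update]
  split_ifs
  · exact mul_pos (hs a) this
  · exact hs a

theorem log_inv_odds_nonneg {e : ℝ} (he : 0 < e) (he' : e < 1 / 2) :
    0 ≤ Real.log (1 / (e / (1 - e))) := by
  refine Real.log_nonneg ?_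
  rw [one_div_div, one_le_div he]
  linarith

/-- Rounds done plus rounds left is constant. Early stops are padded with votes of weight zero, and
a hypothesis without errors counts as a single vote of weight one. Positive weights ensure `e > 0`
when boosting continues, hence nonnegative votes. -/
theorem outcome_mem_boostedClass {X : Type*} {H : Set (X → Bool)} {m n : ℕ}
    {A : (Fin n → X × Bool) → X → Bool} {x : Fin m → X} {y : Fin m → Bool}
    (hA : ∀ σ : Fin n → Fin m, (A fun j => (x (σ j), y (σ j))) ∈ H) (hH : H.Nonempty)
    (l : List (Fin n → Fin m)) {t : ℕ} {s : State X m} (hs : IsVoteSum H t s.score s.total)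
    (hw : ∀ a, 0 < s.weight a) : outcome A x y l s ∈ boostedClass H (t + l.length) := by
  induction l generalizing t s with
  | nil => exact hs.mem_boostedClass
  | cons σ l ih =>
    simp only [outcome, List.length_cons]
    split_ifs with h1 h2
    · rw [show t + (l.length + 1) = 1 + (t + l.length) by omega]
      exact mem_boostedClass_of_mem (hA σ) _
    · exact (hs.add hH _).mem_boostedClass
    · have he := lt_of_le_of_ne (weightedError_nonneg x y hw _) (Ne.symm h1)
      have := ih (hs.succ (hA σ) (log_inv_odds_nonneg he (not_le.1 h2)))
        (s := s.update x y _ _) (State.update_weight_pos x y hw _ he (not_le.1 h2))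
      rwa [show t + (l.length + 1) = t + 1 + l.length by omega]

/-! ### Measurability of the outputs -/

theorem measurable_outcome {X : Type*} [MeasurableSpace X] {m n : ℕ}
    {A : (Fin n → X × Bool) → X → Bool}
    (hA : Measurable fun p : (Fin n → X × Bool) × X => A p.1 p.2) {c : X → Bool}
    (hc : Measurable c) (l : List (Fin n → Fin m)) {s : (Fin m → X) → State X m}
    (hw : ∀ a, Measurable fun x => (s x).weight a)
    (hS : Measurable fun p : (Fin m → X) × X => (s p.1).score p.2)
    (hτ : Measurable fun x => (s x).total) :
    Measurable fun p : (Fin m → X) × X => outcome A p.1 (fun a => c (p.1 a)) l (s p.1) p.2 := by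
  have hvote : ∀ s : (Fin m → X) → State X m,
      (Measurable fun p : (Fin m → X) × X => (s p.1).score p.2) →
      (Measurable fun x => (s x).total) →
      Measurable fun p : (Fin m → X) × X => (s p.1).vote p.2 := by
    intro s hS hτ
    refine measurable_to_bool ?_
    have : (fun p : (Fin m → X) × X => (s p.1).vote p.2) ⁻¹' {true}
        = {p | (1 / 2) * (s p.1).total ≤ (s p.1).score p.2} := by
      ext p; simp [State.vote]
    rw [this]
    exact measurableSet_le ((hτ.comp measurable_fst).const_mul _) hS
  induction l generalizing s with
  | nil => exact hvote s hS hτ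
  | cons σ l ih =>
    let h : (Fin m → X) → X → Bool := fun x => A fun j => (x (σ j), c (x (σ j)))
    let e : (Fin m → X) → ℝ := fun x => weightedError x (fun a => c (x a)) (s x).weight (h x)
    have hh : Measurable fun p : (Fin m → X) × X => h p.1 p.2 := by
      have hpt : Measurable fun p : (Fin m → X) × X =>
          ((fun j => (p.1 (σ j), c (p.1 (σ j))) : Fin n → X × Bool), p.2) := by
        refine Measurable.prodMk (measurable_pi_lambda _ fun j => ?_) measurable_snd
        have h1 : Measurable fun p : (Fin m → X) × X => p.1 (σ j) := by fun_prop
        exact h1.prodMk (hc.comp h1)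
      exact hA.comp hpt
    have hha : ∀ a, MeasurableSet {x : Fin m → X | h x (x a) = c (x a)} := fun a =>
      measurableSet_eq_fun (hh.comp (measurable_id.prodMk (measurable_pi_apply a)))
        (hc.comp (measurable_pi_apply a))
    have he : Measurable e := by
      refine Measurable.div (Finset.measurable_sum _ fun a _ => ?_)
        (Finset.measurable_sum _ fun a _ => hw a)
      exact Measurable.ite (hha a) measurable_const (hw a)
    have hα : Measurable fun x => Real.log (1 / (e x / (1 - e x))) := by fun_prop
    have hrec := ih (s := fun x => (s x).update x (fun a => c (x a)) (h x) (e x))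
      (fun a => Measurable.ite (hha a) ((hw a).mul (by fun_prop)) (hw a))
      (by
        refine hS.add ((hα.comp measurable_fst).mul ?_)
        exact Measurable.ite (hh (measurableSet_singleton true)) measurable_const
          measurable_const)
      (hτ.add hα)
    have he1 : Measurable fun p : (Fin m → X) × X => e p.1 := he.comp measurable_fst
    have : Measurable fun p : (Fin m → X) × X => if e p.1 = 0 then h p.1 p.2 else
        if 1 / 2 ≤ e p.1 then (s p.1).vote p.2 else outcome A p.1 (fun a => c (p.1 a)) l
          ((s p.1).update p.1 (fun a => c (p.1 a)) (h p.1) (e p.1)) p.2 :=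
      Measurable.ite (measurableSet_eq_fun he1 measurable_const :
        MeasurableSet {p : (Fin m → X) × X | e p.1 = 0})
      hh (Measurable.ite (measurableSet_le measurable_const he1 :
        MeasurableSet {p : (Fin m → X) × X | 1 / 2 ≤ e p.1}) (hvote s hS hτ) hrec)
    convert this using 2 with p
    simp only [outcome, h, e]
    split_ifs <;> rfl

/-! ### The training error of AdaBoost -/

/-- The weights after some rounds, expressed by the score and the total. -/
def State.IsExponential {X : Type*} {m : ℕ} (c : X → Bool) (x : Fin m → X) (s : State X m) :
    Prop :=
  ∀ a, s.weight a
    = Real.exp (-(if c (x a) then s.score (x a) else s.total - s.score (x a)))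

/-- The potential whose decay bounds the training error. -/
noncomputable def State.potential {X : Type*} {m : ℕ} (s : State X m) : ℝ :=
  (∑ a, s.weight a) * Real.exp (s.total / 2)

theorem State.IsExponential.weight_pos {X : Type*} {m : ℕ} {c : X → Bool} {x : Fin m → X}
    {s : State X m} (hs : s.IsExponential c x) (a : Fin m) : 0 < s.weight a := by
  rw [hs a]; exact Real.exp_pos _

theorem State.IsExponential.potential_nonneg {X : Type*} {m : ℕ} {c : X → Bool} {x : Fin m → X}
    {s : State X m} (hs : s.IsExponential c x) : 0 ≤ s.potential :=
  mul_nonneg (Finset.sum_nonneg fun a _ => (hs.weight_pos a).le) (Real.exp_pos _).le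

/-- The exponent of a point is minus the total vote that was correct there. Where the majority errs,
at most half of `s.total` was correct, so the point keeps weight at least `exp (-s.total / 2)`. -/
theorem State.IsExponential.errCount_vote_le {X : Type*} {m : ℕ} {c : X → Bool} {x : Fin m → X}
    {s : State X m} (hs : s.IsExponential c x) : (errCount c s.vote x : ℝ) ≤ s.potential := by
  classical
  have h1 : ∀ a ∈ Finset.univ.filter fun a => s.vote (x a) ≠ c (x a),
      Real.exp (-(s.total / 2)) ≤ s.weight a := by
    intro a ha
    have hne := (Finset.mem_filter.1 ha).2
    rw [hs a, Real.exp_le_exp, neg_le_neg_iff]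
    cases hc : c (x a)
    · simp only [hc, State.vote, ne_eq, decide_eq_false_iff_not, not_not] at hne
      simp only [Bool.false_eq_true, if_false]
      linarith
    · simp only [hc, State.vote, ne_eq, decide_eq_true_eq, not_le] at hne
      simp only [if_true]
      linarith
  have h2 := (Finset.card_nsmul_le_sum _ _ _ h1).trans
    (Finset.sum_le_sum_of_subset_of_nonneg (Finset.filter_subset _ _)
      fun a _ _ => (hs.weight_pos a).le)
  rw [nsmul_eq_mul, Real.exp_neg, ← div_eq_mul_inv, div_le_iff₀ (Real.exp_pos _)] at h2
  exact h2

theorem State.IsExponential.update {X : Type*} {m : ℕ} {c : X → Bool} {x : Fin m → X}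
    {s : State X m} (hs : s.IsExponential c x) (h : X → Bool) {e : ℝ} (he : 0 < e)
    (he' : e < 1 / 2) : (s.update x (fun a => c (x a)) h e).IsExponential c x := by
  intro a
  have hβ : 0 < e / (1 - e) := div_pos he (by linarith)
  have hexp : Real.exp (-Real.log (1 / (e / (1 - e)))) = e / (1 - e) := by
    rw [one_div, Real.log_inv, neg_neg, Real.exp_log hβ]
  simp only [State.update, hs a]
  cases hc : c (x a) <;> cases hh : h (x a) <;> simp only [Bool.false_eq_true, if_true, if_false,
    reduceCtorEq, mul_one, mul_zero, add_zero]
  · rw [← hexp, ← Real.exp_add, hexp]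
    congr 1; ring
  · congr 1; ring
  · rw [← hexp, ← Real.exp_add, hexp]
    congr 1; ring

/-- The exact factor is `2 √(e (1 - e))`, which is at most `1 / 2` for `e ≤ 1 / 16`. -/
theorem State.potential_update_le {X : Type*} {m : ℕ} (x : Fin m → X) (y : Fin m → Bool)
    {s : State X m} (hs : ∀ a, 0 < s.weight a) (h : X → Bool)
    (he : 0 < weightedError x y s.weight h) (he' : weightedError x y s.weight h ≤ 1 / 16) :
    (s.update x y h (weightedError x y s.weight h)).potential ≤ s.potential * (1 / 2) := by
  set e := weightedError x y s.weight h with hedef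
  set W := ∑ a, s.weight a with hW
  have hW0 : 0 ≤ W := Finset.sum_nonneg fun a _ => (hs a).le
  have hWpos : W ≠ 0 := by
    intro h0
    rw [hedef, weightedError, ← hW, h0, div_zero] at he
    exact lt_irrefl _ he
  have hwrong : (∑ a, if h (x a) = y a then 0 else s.weight a) = e * W := by
    rw [hedef, weightedError, div_mul_cancel₀ _ hWpos]
  -- The correct points, of weight `(1 - e) W`, are scaled down to `e W`, which equals the weight of
  -- the wrong ones.
  have hsum : ∑ a, (s.update x y h e).weight a = 2 * e * W := by
    have : ∀ a, (s.update x y h e).weight a = s.weight a * (e / (1 - e)) +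
        (if h (x a) = y a then 0 else s.weight a) * (1 - e / (1 - e)) := by
      intro a
      simp only [State.update]
      split_ifs <;> ring
    simp_rw [this, Finset.sum_add_distrib, ← Finset.sum_mul]
    rw [hwrong, ← hW]
    field_simp [show (1 - e) ≠ 0 by linarith]
    ring
  have hroot : Real.exp (Real.log (1 / (e / (1 - e))) / 2) ≤ 1 / (4 * e) := by
    rw [Real.exp_half, Real.exp_log (by rw [one_div_div]; exact div_pos (by linarith) he),
      one_div_div]
    refine Real.sqrt_le_iff.2 ⟨by positivity, ?_⟩
    rw [div_pow, div_le_div_iff₀ he (by positivity)]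
    nlinarith
  rw [State.potential, hsum, State.potential, ← hW]
  have : (s.update x y h e).total / 2 = s.total / 2 + Real.log (1 / (e / (1 - e))) / 2 := by
    simp only [State.update]; ring
  rw [this, Real.exp_add]
  calc 2 * e * W * (Real.exp (s.total / 2) * Real.exp (Real.log (1 / (e / (1 - e))) / 2))
      ≤ 2 * e * W * (Real.exp (s.total / 2) * (1 / (4 * e))) := by gcongr
    _ = _ := by field_simp; ring

theorem errCount_eq_zero_of_weightedError {X : Type*} {m : ℕ} {c : X → Bool} {x : Fin m → X}
    {w : Fin m → ℝ} (hw : ∀ a, 0 < w a) {h : X → Bool}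
    (he : weightedError x (fun a => c (x a)) w h = 0) : errCount c h x = 0 := by
  rw [errCount, Finset.card_eq_zero, Finset.filter_eq_empty_iff]
  intro a _ hne
  have hWpos : 0 < ∑ a, w a := Finset.sum_pos (fun a _ => hw a) ⟨a, Finset.mem_univ a⟩
  rw [weightedError, div_eq_zero_iff, or_iff_left hWpos.ne',
    Finset.sum_eq_zero_iff_of_nonneg fun a _ => by split_ifs; exacts [le_rfl, (hw a).le]] at he
  have := he a (Finset.mem_univ a)
  rw [if_neg hne] at this
  exact (hw a).ne' this

theorem toOuterMeasure_le_one {α : Type*} (p : PMF α) (s : Set α) : p.toOuterMeasure s ≤ 1 := by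
  rw [PMF.toOuterMeasure_apply, ← p.tsum_coe]
  exact ENNReal.tsum_le_tsum fun a => Set.indicator_le_self _ _ a

/-- If in every round the weak hypothesis has weighted error above `1 / 16` with probability at
most `η`, the training error is small with probability at least `1 - T * η`. -/
theorem boost_training_error {X : Type*} {m n : ℕ}
    (resample : (Fin m → ℝ) → PMF (Fin n → Fin m)) (A : (Fin n → X × Bool) → X → Bool)
    (c : X → Bool) (x : Fin m → X) {η : ℝ≥0∞}
    (hη : ∀ w : Fin m → ℝ, (∀ a, 0 < w a) → (resample w).toOuterMeasure
      {σ | 1 / 16 < weightedError x (fun a => c (x a)) w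
        (A fun j => (x (σ j), c (x (σ j))))} ≤ η)
    (T : ℕ) {s : State X m} (hs : s.IsExponential c x) :
    (boost resample A x (fun a => c (x a)) T s).toOuterMeasure
      {f | s.potential * (1 / 2) ^ T < errCount c f x} ≤ T * η := by
  induction T generalizing s with
  | zero =>
    rw [boost, PMF.toOuterMeasure_pure_apply, if_neg]
    · simp
    · simpa using hs.errCount_vote_le
  | succ T ih =>
    rw [boost, PMF.toOuterMeasure_bind_apply]
    set bad := {σ : Fin n → Fin m | 1 / 16 < weightedError x (fun a => c (x a)) s.weight
        (A fun j => (x (σ j), c (x (σ j))))} with hbad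
    calc _ ≤ ∑' σ, (bad.indicator (resample s.weight) σ + resample s.weight σ * (T * η)) := by
          refine ENNReal.tsum_le_tsum fun σ => ?_
          by_cases hσ : σ ∈ bad
          · rw [Set.indicator_of_mem hσ]
            refine le_add_right ?_
            exact mul_le_of_le_one_right zero_le (toOuterMeasure_le_one _ _)
          · rw [Set.indicator_of_notMem hσ, zero_add]
            refine mul_le_mul_right ?_ _
            dsimp only
            have hσ' := not_lt.1 (show ¬ (1 / 16 < weightedError x (fun a => c (x a)) s.weight
              (A fun j => (x (σ j), c (x (σ j))))) from hσ)
            split_ifs with h1 h2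
            · rw [PMF.toOuterMeasure_pure_apply, if_neg]
              · exact zero_le
              · simp only [Set.mem_ofPred_eq, not_lt,
                  errCount_eq_zero_of_weightedError hs.weight_pos h1, Nat.cast_zero]
                exact mul_nonneg hs.potential_nonneg (by positivity)
            -- Stopping for `e ≥ 1 / 2` cannot occur outside `bad`, where `e ≤ 1 / 16`.
            · linarith
            · have he := lt_of_le_of_ne (weightedError_nonneg x _ hs.weight_pos _) (Ne.symm h1)
              refine le_trans (measure_mono fun f hf => ?_)
                (ih (hs.update _ he (not_le.1 h2)))
              simp only [Set.mem_ofPred_eq] at hf ⊢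
              refine lt_of_le_of_lt ?_ hf
              rw [pow_succ', ← mul_assoc]
              exact mul_le_mul_of_nonneg_right
                (State.potential_update_le x _ hs.weight_pos _ he hσ') (by positivity)
      _ = (resample s.weight).toOuterMeasure bad + T * η := by
          rw [ENNReal.tsum_add, ENNReal.tsum_mul_right, PMF.tsum_coe, one_mul,
            PMF.toOuterMeasure_apply]
      _ ≤ η + T * η := by gcongr; exact hη _ hs.weight_pos
      _ = _ := by push_cast; ring

/-! ### Distributed resampling is centralized resampling -/

theorem draw_apply {ι : Type*} [Fintype ι] [Nonempty ι] {w : ι → ℝ}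
    (hw : ∑ i, ENNReal.ofReal (w i) ≠ 0) (i : ι) :
    draw w i = ENNReal.ofReal (w i) * (∑ i, ENNReal.ofReal (w i))⁻¹ := by
  rw [draw, dif_neg hw, PMF.normalize_apply, tsum_fintype]

theorem sum_ofReal_ne_zero {m : ℕ} [NeZero m] {w : Fin m → ℝ} (hw : ∀ a, 0 < w a) :
    ∑ a, ENNReal.ofReal (w a) ≠ 0 := by
  intro h
  have := (Finset.sum_eq_zero_iff.1 h) 0 (Finset.mem_univ _)
  exact absurd (ENNReal.ofReal_eq_zero.1 this) (not_le.2 (hw 0))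

theorem indepDraws_apply {ι : Type*} [Fintype ι] {n : ℕ} (p : Fin n → PMF ι) (f : Fin n → ι) :
    indepDraws p f = ∏ j, p j (f j) := by
  rw [indepDraws, PMF.ofFintype_apply]

/-- Drawing a player and then a point of the player's reservoir amounts to drawing a point. -/
theorem sum_draw_mul_draw {m k : ℕ} [NeZero m] [NeZero k] (owner : Fin m → Fin k)
    {w : Fin m → ℝ} (hw : ∀ a, 0 < w a) (a : Fin m) :
    ∑ i, draw (fun i : Fin k => ∑ a, if owner a = i then w a else 0) i *
      draw (fun a => if owner a = i then w a else 0) a = draw w a := by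
  have hW : ∀ i, ∑ b, ENNReal.ofReal (if owner b = i then w b else 0)
      = ENNReal.ofReal (∑ b, if owner b = i then w b else 0) := fun i => by
    rw [ENNReal.ofReal_sum_of_nonneg]
    intro b _
    split_ifs
    exacts [(hw b).le, le_rfl]
  have htot : ∑ i : Fin k, ENNReal.ofReal (∑ b, if owner b = i then w b else 0)
      = ∑ b, ENNReal.ofReal (w b) := by
    simp_rw [← hW]
    rw [Finset.sum_comm]
    refine Finset.sum_congr rfl fun b _ => ?_
    rw [Finset.sum_eq_single (owner b)]
    · simp
    · intro i _ hi
      simp [Ne.symm hi]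
    · simp
  have hne := sum_ofReal_ne_zero hw
  have hpos : 0 < ∑ b, if owner b = owner a then w b else 0 :=
    Finset.sum_pos' (fun b _ => by split_ifs; exacts [(hw b).le, le_rfl])
      ⟨a, Finset.mem_univ _, by simpa using hw a⟩
  have hpos' : ENNReal.ofReal (∑ b, if owner b = owner a then w b else 0) ≠ 0 :=
    (ENNReal.ofReal_pos.2 hpos).ne'
  rw [Finset.sum_eq_single (owner a)]
  · rw [draw_apply (by rwa [htot]), draw_apply (by rwa [hW]), draw_apply hne, htot, hW,
      if_pos rfl]
    rw [mul_comm, ← mul_assoc, mul_assoc (ENNReal.ofReal (w a)),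
      ENNReal.inv_mul_cancel hpos' ENNReal.ofReal_ne_top, mul_one]
  · intro i _ hi
    rw [draw_apply (by rwa [htot])]
    -- A player of zero reservoir weight is never drawn, so the default value of `draw` for that
    -- player is harmless.
    by_cases h0 : ENNReal.ofReal (∑ b, if owner b = i then w b else 0) = 0
    · rw [h0]; simp
    · rw [draw_apply (w := fun b => if owner b = i then w b else 0) (by rwa [hW]),
        if_neg (Ne.symm hi)]
      simp
  · simp

theorem distResample_eq_centralResample {m k : ℕ} [NeZero m] [NeZero k] (owner : Fin m → Fin k)
    (n : ℕ) {w : Fin m → ℝ} (hw : ∀ a, 0 < w a) :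
    distResample owner n w = centralResample n w := by
  refine PMF.ext fun σ => ?_
  rw [distResample, centralResample, PMF.bind_apply, tsum_fintype, indepDraws_apply]
  simp_rw [indepDraws_apply, ← Finset.prod_mul_distrib]
  rw [← Fintype.piFinset_univ, ← Finset.prod_univ_sum (fun _ : Fin n => Finset.univ) fun j i =>
    draw (fun i : Fin k => ∑ a, if owner a = i then w a else 0) i *
      draw (fun a => if owner a = i then w a else 0) (σ j)]
  exact Finset.prod_congr rfl fun j _ => sum_draw_mul_draw owner hw (σ j)

/-- Boosting continues only when `0 < e < 1 / 2`, so the weights remain positive and the resampling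
rules are never compared elsewhere. -/
theorem boost_congr {X : Type*} {m n : ℕ} {r r' : (Fin m → ℝ) → PMF (Fin n → Fin m)}
    (hr : ∀ w : Fin m → ℝ, (∀ a, 0 < w a) → r w = r' w) (A : (Fin n → X × Bool) → X → Bool)
    (x : Fin m → X) (y : Fin m → Bool) (T : ℕ) {s : State X m} (hs : ∀ a, 0 < s.weight a) :
    boost r A x y T s = boost r' A x y T s := by
  induction T generalizing s with
  | zero => rfl
  | succ T ih =>
    rw [boost, boost, hr _ hs]
    congr 1
    funext σ
    dsimp only
    split_ifs with h1 h2
    · rfl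
    · rfl
    · exact ih (State.update_weight_pos x y hs _
        (lt_of_le_of_ne (weightedError_nonneg x y hs _) (Ne.symm h1)) (not_le.1 h2))

theorem isProbabilityMeasure_mixture {X : Type*} [MeasurableSpace X] {k : ℕ} [NeZero k]
    (D : Fin k → Measure X) (hD : ∀ i, IsProbabilityMeasure (D i)) :
    IsProbabilityMeasure (mixture D) := by
  constructor
  have hk : (k : ℝ≥0∞) ≠ 0 := by exact_mod_cast NeZero.ne k
  simp [mixture, ENNReal.inv_mul_cancel hk]

theorem mixture_const {X : Type*} [MeasurableSpace X] {k : ℕ} [NeZero k] (μ : Measure X) :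
    mixture (fun _ : Fin k => μ) = μ := by
  have hk : (k : ℝ≥0∞) ≠ 0 := by exact_mod_cast NeZero.ne k
  ext s _
  simp [mixture, ← mul_assoc, ENNReal.inv_mul_cancel hk]

theorem pi_mixture {X : Type*} [MeasurableSpace X] {m k : ℕ} [NeZero k]
    (D : Fin k → Measure X) (hD : ∀ i, IsProbabilityMeasure (D i)) :
    Measure.pi (fun _ : Fin m => mixture D)
      = ∑ owner : Fin m → Fin k, (k : ℝ≥0∞)⁻¹ ^ m • Measure.pi fun a => D (owner a) := by
  have := isProbabilityMeasure_mixture D hD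
  refine Measure.pi_eq fun s _ => ?_
  simp only [mixture, Measure.coe_finsetSum, Measure.smul_apply, Finset.sum_apply,
    Measure.coe_smul, Pi.smul_apply, smul_eq_mul, Measure.pi_pi, Finset.prod_mul_distrib,
    Finset.prod_const, Finset.card_univ, Fintype.card_fin]
  rw [← Finset.mul_sum, Finset.prod_univ_sum, Fintype.piFinset_univ]

theorem distBoostSuccess_eq {X : Type*} [MeasurableSpace X] {n : ℕ}
    (A : (Fin n → X × Bool) → X → Bool) (T m : ℕ) [NeZero m] {k : ℕ} [NeZero k] (ε : ℝ)
    (D : Fin k → Measure X) (hD : ∀ i, IsProbabilityMeasure (D i)) (c : X → Bool) :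
    distBoostSuccess A T m ε D c = adaBoostSuccess A T m ε (mixture D) c := by
  rw [adaBoostSuccess, pi_mixture D hD, lintegral_finsetSum_measure, distBoostSuccess]
  refine Finset.sum_congr rfl fun owner _ => ?_
  rw [lintegral_smul_measure, indepDraws_apply, smul_eq_mul]
  congr 1
  · simp
  · refine lintegral_congr fun x => ?_
    rw [boost_congr (fun w hw => distResample_eq_centralResample owner n hw) A x _ T
      (fun _ => one_pos)]

theorem distBoostSampleComplexity_eq {X : Type*} [MeasurableSpace X] (H : Set (X → Bool)) {n : ℕ}
    (A : (Fin n → X × Bool) → X → Bool) (T k : ℕ) [NeZero k] (ε δ : ℝ) :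
    distBoostSampleComplexity H A T k ε δ = adaBoostSampleComplexity H A T ε δ := by
  rw [distBoostSampleComplexity, adaBoostSampleComplexity]
  refine iInf_congr fun m => iInf_congr_Prop ?_ fun _ => rfl
  refine and_congr_right fun _ => forall_congr' fun m' => forall_congr' fun _ =>
    forall_congr' fun _ => ⟨fun h μ hμ c hc => ?_, fun h D hD c hc => ?_⟩
  · have := h (fun _ => μ) (fun _ => hμ) c hc
    rwa [distBoostSuccess_eq A T m' ε _ (fun _ => hμ), mixture_const] at this
  · rw [distBoostSuccess_eq A T m' ε D hD]
    exact h _ (isProbabilityMeasure_mixture D hD) c hc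

/-! ### The weak learner in one round -/

/-- Since `(2 + ε) ^ N = 2 ^ N (1 + ε / 2) ^ N` and `2 ^ N ≤ 2 ^ a * 2 ^ (N - a)`, also under
truncated subtraction, the factor `4 ^ N` cancels. -/
theorem le_ofReal_of_double_sample {N a Γ : ℕ} {ε B : ℝ} (hε : 0 ≤ ε) {p : ℝ≥0∞}
    (hp : 2 ^ (N - a) * (2 + ENNReal.ofReal ε) ^ N * p ≤ Γ * 4 ^ N) (hB : (Γ : ℝ) ≤ B) :
    p ≤ ENNReal.ofReal (B * 2 ^ a / (1 + ε / 2) ^ N) := by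
  have h1 : (2 : ℝ≥0∞) + ENNReal.ofReal ε = 2 * ENNReal.ofReal (1 + ε / 2) := by
    rw [show (2 : ℝ≥0∞) = ENNReal.ofReal 2 by simp, ← ENNReal.ofReal_add (by norm_num) hε,
      ← ENNReal.ofReal_mul (by norm_num)]
    congr 1; ring
  have h2 : (4 : ℝ≥0∞) ^ N * (ENNReal.ofReal (1 + ε / 2) ^ N * p) ≤ 4 ^ N * (Γ * 2 ^ a) := by
    calc (4 : ℝ≥0∞) ^ N * (ENNReal.ofReal (1 + ε / 2) ^ N * p)
        = 2 ^ N * ((2 * ENNReal.ofReal (1 + ε / 2)) ^ N * p) := by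
          rw [show (4 : ℝ≥0∞) = 2 * 2 by norm_num, mul_pow, mul_pow]; ring
      _ ≤ (2 ^ a * 2 ^ (N - a)) * ((2 * ENNReal.ofReal (1 + ε / 2)) ^ N * p) := by
          gcongr
          rw [← pow_add]
          exact pow_le_pow_right₀ (by norm_num) (by omega)
      _ = 2 ^ a * (2 ^ (N - a) * (2 + ENNReal.ofReal ε) ^ N * p) := by rw [h1]; ring
      _ ≤ 2 ^ a * (Γ * 4 ^ N) := by gcongr
      _ = _ := by ring
  have h3 := (ENNReal.mul_le_mul_iff_right (by simp) (by simp)).1 h2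
  have hpos : 0 < (1 + ε / 2) ^ N := by positivity
  rw [ENNReal.ofReal_div_of_pos hpos, ENNReal.le_div_iff_mul_le
    (Or.inl (ENNReal.ofReal_pos.2 hpos).ne') (Or.inl ENNReal.ofReal_ne_top),
    ENNReal.ofReal_pow (by positivity), mul_comm]
  refine h3.trans ?_
  rw [ENNReal.ofReal_mul' (by positivity), ENNReal.ofReal_pow (by norm_num)]
  gcongr
  · rw [← ENNReal.ofReal_natCast]; exact ENNReal.ofReal_le_ofReal hB
  · simp

theorem toMeasure_indepDraws_const {m n : ℕ} (p : PMF (Fin m)) :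
    (indepDraws fun _ : Fin n => p).toMeasure = Measure.pi fun _ => p.toMeasure := by
  refine Measure.ext_of_singleton fun σ => ?_
  rw [PMF.toMeasure_apply_singleton _ _ (measurableSet_singleton _), indepDraws_apply,
    Measure.pi_singleton]
  exact Finset.prod_congr rfl fun j _ =>
    (PMF.toMeasure_apply_singleton _ _ (measurableSet_singleton _)).symm

theorem toMeasure_draw_errors {X : Type*} {m : ℕ} [NeZero m] (x : Fin m → X) (y : Fin m → Bool)
    {w : Fin m → ℝ} (hw : ∀ a, 0 < w a) (h : X → Bool) :
    (draw w).toMeasure {a | h (x a) ≠ y a} = ENNReal.ofReal (weightedError x y w h) := by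
  have hW : 0 < ∑ a, w a := Finset.sum_pos (fun a _ => hw a) Finset.univ_nonempty
  rw [PMF.toMeasure_apply_fintype, weightedError, ENNReal.ofReal_div_of_pos hW,
    ENNReal.ofReal_sum_of_nonneg fun a _ => (hw a).le, div_eq_mul_inv,
    ENNReal.ofReal_sum_of_nonneg fun a _ => by split_ifs; exacts [le_rfl, (hw a).le],
    Finset.sum_mul]
  refine Finset.sum_congr rfl fun a _ => ?_
  by_cases ha : h (x a) = y a
  · simp [ha]
  · rw [Set.indicator_of_mem (by exact ha), draw_apply (sum_ofReal_ne_zero hw), if_neg ha]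

theorem traces_image_comp {X Y ι : Type*} [Fintype ι] (H : Set (X → Bool)) (x : Y → X)
    (u : ι → Y) : traces ((fun h a => h (x a)) '' H) u = traces H (fun j => x (u j)) := by
  ext τ
  simp [mem_traces]

/-- The probability that the weak hypothesis of a round has weighted error above `1 / 16`. -/
theorem weak_hypothesis_error_le {X : Type*} {H : Set (X → Bool)} {d m n : ℕ} [NeZero m]
    (hd : vcDim H ≤ d) {A : (Fin n → X × Bool) → X → Bool} (hA : IsConsistentLearner H A)
    {c : X → Bool} (hc : c ∈ H) (x : Fin m → X) {w : Fin m → ℝ} (hw : ∀ a, 0 < w a) :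
    (centralResample n w).toOuterMeasure
      {σ | 1 / 16 < weightedError x (fun a => c (x a)) w (A fun j => (x (σ j), c (x (σ j))))}
      ≤ ENNReal.ofReal (128 ^ d * (1 + 1 / 128) ^ (2 * n) / (1 + 1 / 32) ^ n) := by
  have hcons : ∀ σ : Fin n → Fin m, _ := fun σ =>
    hA (fun j => (x (σ j), c (x (σ j)))) ⟨c, hc, fun _ => rfl⟩
  -- The double-sample bound is applied on the finite space `Fin m` with law `draw w`, to the class
  -- pulled back to indices. Consistency means zero empirical errors.
  have key := measure_low_empirical_error_le (draw w).toMeasure (N := n)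
    (G := (fun h a => h (x a)) '' H) (Γ := ∑ k ∈ Finset.Iic d, (2 * n).choose k)
    (fun u => by
      rw [traces_image_comp]
      simpa [mul_comm] using card_traces_le_sum hd fun j => x (u j))
    (c := fun a => c (x a)) (Measurable.of_discrete)
    (fun (_ : Unit) σ a => A (fun j => (x (σ j), c (x (σ j)))) (x a))
    (fun _ => Measurable.of_discrete) (fun _ σ => ⟨_, (hcons σ).1, rfl⟩) 0
    (ENNReal.ofReal (1 / 16))
  have h1 := le_ofReal_of_double_sample (by norm_num) key
    (sum_choose_le d (2 * n) (r := 1 / 128) (by norm_num) (by norm_num))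
  rw [← toMeasure_indepDraws_const, PMF.toMeasure_apply_eq_toOuterMeasure] at h1
  refine (measure_mono ?_).trans (h1.trans (ENNReal.ofReal_le_ofReal (le_of_eq ?_)))
  · intro σ hσ
    refine ⟨(), ?_, ?_⟩
    · simp only [errCount, nonpos_iff_eq_zero, Finset.card_eq_zero, Finset.filter_eq_empty_iff]
      intro j _
      simpa using (hcons σ).2 j
    · rw [toMeasure_draw_errors x (fun a => c (x a)) hw]
      exact ENNReal.ofReal_le_ofReal (le_of_lt hσ)
  · norm_num

theorem weak_bound_le {d n : ℕ} {L : ℝ} (hL : 0 ≤ L) (hn : 1000 * (d + L) ≤ n) :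
    (128 ^ d * (1 + 1 / 128) ^ (2 * n) / (1 + 1 / 32) ^ n : ℝ) ≤ Real.exp (-L) := by
  have e1 : (128 : ℝ) ≤ Real.exp 5 := by
    rw [← Real.log_le_iff_le_exp (by norm_num), show (128 : ℝ) = 2 ^ 7 by norm_num, Real.log_pow]
    have := Real.log_two_lt_d9
    norm_num
    linarith
  have e2 : (1 + 1 / 128 : ℝ) ≤ Real.exp (1 / 128) := by
    linarith [Real.add_one_le_exp (1 / 128 : ℝ)]
  have e3 : Real.exp (1 / 33) ≤ (1 + 1 / 32 : ℝ) := by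
    rw [← Real.le_log_iff_exp_le (by norm_num)]
    have := Real.one_sub_inv_le_log_of_pos (show (0 : ℝ) < 1 + 1 / 32 by norm_num)
    norm_num at this ⊢
    linarith
  calc _ ≤ Real.exp 5 ^ d * Real.exp (1 / 128) ^ (2 * n) / Real.exp (1 / 33) ^ n := by gcongr
    _ = Real.exp (d * 5 + (2 * n : ℕ) * (1 / 128) - n * (1 / 33)) := by
      simp only [← Real.exp_nat_mul, ← Real.exp_add, ← Real.exp_sub]
    _ ≤ _ := by
      rw [Real.exp_le_exp]
      push_cast
      have : (0 : ℝ) ≤ d := Nat.cast_nonneg _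
      linarith

/-- The gain `exp (-ε m / 3)` from the denominator beats both the growth `exp (ε m / 32)`, kept
small by `r = ε / 64`, and the cost `2 ^ (ε m / 8)` of the tolerated training errors. -/
theorem vote_bound_le {dB m : ℕ} {ε L : ℝ} (hε : 0 < ε) (hε1 : ε < 1) (hL : 0 ≤ L)
    (hm : 1000 * (dB * Real.log (2 / ε) + L) / ε ≤ m) :
    ((1 / (ε / 64)) ^ dB * (1 + ε / 64) ^ (2 * m) * 2 ^ ⌊ε * m / 8⌋₊ / (1 + ε / 2) ^ m : ℝ)
      ≤ Real.exp (-L) := by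
  have hlog2 := Real.log_two_lt_d9
  have hlog2' := Real.log_two_gt_d9
  have hl : Real.log 2 ≤ Real.log (2 / ε) :=
    Real.log_le_log (by norm_num) (by rw [le_div_iff₀ hε]; linarith)
  have e1 : 1 / (ε / 64) ≤ Real.exp (6 * Real.log (2 / ε)) := by
    rw [← Real.log_le_iff_le_exp (by positivity),
      show 1 / (ε / 64) = 2 ^ 5 * (2 / ε) by field_simp; norm_num,
      Real.log_mul (by norm_num) (by positivity), Real.log_pow]
    push_cast
    linarith
  have e2 : 1 + ε / 64 ≤ Real.exp (ε / 64) := by linarith [Real.add_one_le_exp (ε / 64)]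
  have e3 : Real.exp (ε / 3) ≤ 1 + ε / 2 := by
    rw [← Real.le_log_iff_exp_le (by positivity)]
    refine le_trans ?_ (Real.one_sub_inv_le_log_of_pos (by positivity))
    rw [← sub_nonneg]
    have : 1 - (1 + ε / 2)⁻¹ - ε / 3 = ε * (1 - ε) / (6 * (1 + ε / 2)) := by
      field_simp; ring
    rw [this]
    exact div_nonneg (mul_nonneg hε.le (by linarith)) (by positivity)
  have e4 : (2 : ℝ) ^ ⌊ε * m / 8⌋₊ ≤ Real.exp (ε * m / 8 * Real.log 2) := by
    rw [← Real.rpow_natCast, Real.rpow_def_of_pos (by norm_num), Real.exp_le_exp, mul_comm]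
    exact mul_le_mul_of_nonneg_right (Nat.floor_le (by positivity)) (by linarith)
  calc _ ≤ Real.exp (6 * Real.log (2 / ε)) ^ dB * Real.exp (ε / 64) ^ (2 * m) *
        Real.exp (ε * m / 8 * Real.log 2) / Real.exp (ε / 3) ^ m := by gcongr
    _ = Real.exp (dB * (6 * Real.log (2 / ε)) + (2 * m : ℕ) * (ε / 64) + ε * m / 8 * Real.log 2
        - m * (ε / 3)) := by
      simp only [← Real.exp_nat_mul, ← Real.exp_add, ← Real.exp_sub]
    _ ≤ _ := by
      rw [Real.exp_le_exp]
      push_cast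
      rw [div_le_iff₀ hε] at hm
      have h0 : (0 : ℝ) ≤ dB * Real.log (2 / ε) :=
        mul_nonneg (Nat.cast_nonneg _) (by linarith)
      have hεm : 0 ≤ m * ε := by positivity
      have h1 : ε * m / 8 * Real.log 2 ≤ m * ε * (1 / 8) := by nlinarith
      nlinarith

/-! ### Success of AdaBoost -/

theorem State.isExponential_init {X : Type*} {m : ℕ} (c : X → Bool) (x : Fin m → X) :
    (State.init X m).IsExponential c x := by
  intro a
  simp [State.init]

theorem State.potential_init (X : Type*) (m : ℕ) : (State.init X m).potential = m := by
  simp [State.init, State.potential]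

theorem half_pow_le {ε : ℝ} (hε : 0 < ε) (hε1 : ε < 1) {T : ℕ}
    (hT : 1000 * Real.log (2 / ε) ≤ T) : (1 / 2 : ℝ) ^ T ≤ ε / 8 := by
  have hlog2 := Real.log_two_gt_d9
  have hl : Real.log 2 ≤ Real.log (2 / ε) :=
    Real.log_le_log (by norm_num) (by rw [le_div_iff₀ hε]; linarith)
  have h8 : Real.log (8 / ε) = 2 * Real.log 2 + Real.log (2 / ε) := by
    rw [show 8 / ε = 2 ^ 2 * (2 / ε) by ring, Real.log_mul (by norm_num) (by positivity),
      Real.log_pow]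
    norm_num
  have h : 8 / ε ≤ 2 ^ T := by
    rw [← Real.log_le_log_iff (by positivity) (by positivity), Real.log_pow, h8]
    nlinarith
  rw [div_pow, one_pow, one_div, show ε / 8 = (8 / ε)⁻¹ by rw [inv_div]]
  exact inv_anti₀ (by positivity) h

theorem adaBoostSuccess_ge {X : Type*} [MeasurableSpace X] {H : Set (X → Bool)} {d dB n T m : ℕ}
    [NeZero m] (hH : ∀ h ∈ H, Measurable h) (hd : vcDim H ≤ d)
    (hdB : vcDim (boostedClass H T) ≤ dB) {ε δ : ℝ} (hε : 0 < ε) (hε1 : ε < 1) (hδ : 0 < δ)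
    (hδ1 : δ < 1) (hT : 1000 * Real.log (2 / ε) ≤ T) (hT1 : 1 ≤ T)
    (hn : 1000 * (d + Real.log (2 * T / δ)) ≤ n) {A : (Fin n → X × Bool) → X → Bool}
    (hA : IsConsistentLearner H A)
    (hAm : Measurable fun p : (Fin n → X × Bool) × X => A p.1 p.2)
    (hm : 1000 * (dB * Real.log (2 / ε) + Real.log (2 / δ)) / ε ≤ m)
    (μ : Measure X) [IsProbabilityMeasure μ] {c : X → Bool} (hc : c ∈ H) :
    ENNReal.ofReal (1 - δ) ≤ adaBoostSuccess A T m ε μ c := by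
  have hT1' : (1 : ℝ) ≤ T := by exact_mod_cast hT1
  let good : Set (X → Bool) := {f | μ {z | f z ≠ c z} < ENNReal.ofReal ε}
  let F : {l : List (Fin n → Fin m) // l.length = T} → (Fin m → X) → X → Bool :=
    fun l x => outcome A x (fun a => c (x a)) l.1 (State.init X m)
  let B : Set (Fin m → X) := {x | ∃ l, errCount c (F l x) x ≤ ⌊ε * m / 8⌋₊ ∧
    ENNReal.ofReal ε ≤ μ {z | F l x z ≠ c z}}
  set P := Measure.pi fun _ : Fin m => μ with hP
  have hB : P B ≤ ENNReal.ofReal (δ / 2) := by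
    have h1 := measure_low_empirical_error_le μ (G := boostedClass H T)
      (Γ := ∑ k ∈ Finset.Iic dB, (2 * m).choose k)
      (fun u => by simpa [mul_comm] using card_traces_le_sum hdB u) (hH c hc) F
      (fun l => measurable_outcome hAm (hH c hc) l.1 (s := fun _ => State.init X m)
        (fun _ => measurable_const) measurable_const measurable_const)
      (fun l x => by
        have := outcome_mem_boostedClass (A := A) (x := x) (y := fun a => c (x a))
          (fun σ => (hA (fun j => (x (σ j), c (x (σ j)))) ⟨c, hc, fun _ => rfl⟩).1) ⟨c, hc⟩ l.1
          (s := State.init X m) (isVoteSum_zero H) (fun _ => one_pos)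
        rwa [zero_add, l.2] at this) ⌊ε * m / 8⌋₊ (ENNReal.ofReal ε)
    refine (le_ofReal_of_double_sample hε.le h1 (sum_choose_le dB (2 * m) (r := ε / 64)
      (by positivity) (by linarith))).trans (ENNReal.ofReal_le_ofReal ?_)
    refine (vote_bound_le hε hε1 (Real.log_nonneg ?_) hm).trans (le_of_eq ?_)
    · rw [le_div_iff₀ hδ]; linarith
    · rw [Real.exp_neg, Real.exp_log (by positivity), inv_div]
  have hround : ∀ x : Fin m → X, x ∉ B →
      ENNReal.ofReal (1 - δ / 2) ≤ (boost (centralResample n) A x (fun a => c (x a)) T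
        (State.init X m)).toOuterMeasure good := by
    intro x hx
    set p := boost (centralResample n) A x (fun a => c (x a)) T (State.init X m) with hp
    have hη : ∀ w : Fin m → ℝ, (∀ a, 0 < w a) → (centralResample n w).toOuterMeasure
        {σ | 1 / 16 < weightedError x (fun a => c (x a)) w
          (A fun j => (x (σ j), c (x (σ j))))} ≤ ENNReal.ofReal (δ / (2 * T)) := by
      intro w hw
      refine (weak_hypothesis_error_le hd hA hc x hw).trans (ENNReal.ofReal_le_ofReal ?_)
      refine (weak_bound_le (Real.log_nonneg ?_) hn).trans (le_of_eq ?_)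
      · rw [le_div_iff₀ hδ]; linarith
      · rw [Real.exp_neg, Real.exp_log (by positivity), inv_div]
    have htrain := boost_training_error (centralResample n) A c x hη T
      (State.isExponential_init c x)
    have hTη : (T : ℝ≥0∞) * ENNReal.ofReal (δ / (2 * T)) = ENNReal.ofReal (δ / 2) := by
      rw [← ENNReal.ofReal_natCast, ← ENNReal.ofReal_mul (by positivity)]
      congr 1
      field_simp
    rw [hTη, State.potential_init, ← hp] at htrain
    have hbad : p.toOuterMeasure goodᶜ ≤ ENNReal.ofReal (δ / 2) := by
      -- Only outputs in the support matter. For such an output, small training error and true error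
      -- at least `ε` would put `x` in `B`.
      refine le_trans (PMF.toOuterMeasure_mono p ?_) htrain
      rintro f ⟨hf, hsupp⟩
      obtain ⟨l, hl, rfl⟩ := exists_outcome_of_mem_support _ _ _ _ _ _ _ hsupp
      by_contra hle
      refine hx ⟨⟨l, hl⟩, Nat.le_floor ?_, not_lt.1 hf⟩
      refine (not_lt.1 hle).trans ?_
      have := mul_le_mul_of_nonneg_left (half_pow_le hε hε1 hT) (Nat.cast_nonneg (α := ℝ) m)
      linarith
    have hone : 1 ≤ p.toOuterMeasure good + p.toOuterMeasure goodᶜ := by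
      have hu : p.toOuterMeasure Set.univ = 1 :=
        (PMF.toOuterMeasure_apply_eq_one_iff p _).2 (Set.subset_univ _)
      rw [← hu, ← Set.union_compl_self good]
      exact measure_union_le _ _
    rw [ENNReal.ofReal_sub _ (by positivity), ENNReal.ofReal_one, tsub_le_iff_right]
    exact hone.trans (by gcongr)
  -- `B` is not known to be measurable, so the integral is bounded below on the complement of its
  -- measurable hull, which has the same measure.
  have hBm := measurableSet_toMeasurable P B
  calc ENNReal.ofReal (1 - δ) ≤ ENNReal.ofReal (1 - δ / 2) * ENNReal.ofReal (1 - δ / 2) := by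
        rw [← ENNReal.ofReal_mul (by linarith)]
        exact ENNReal.ofReal_le_ofReal (by nlinarith)
    _ ≤ ENNReal.ofReal (1 - δ / 2) * P (toMeasurable P B)ᶜ := by
        rw [prob_compl_eq_one_sub hBm, measure_toMeasurable, ENNReal.ofReal_sub 1 (by positivity),
          ENNReal.ofReal_one]
        gcongr
    _ = ∫⁻ x, (toMeasurable P B)ᶜ.indicator (fun _ => ENNReal.ofReal (1 - δ / 2)) x ∂P :=
        (lintegral_indicator_const hBm.compl _).symm
    _ ≤ _ := by
        refine lintegral_mono fun x => ?_
        by_cases hx : x ∈ toMeasurable P B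
        · simp [hx]
        · rw [Set.indicator_of_mem (by exact hx)]
          exact hround x fun h => hx (subset_toMeasurable P B h)

theorem adaBoostSampleComplexity_le {X : Type*} [MeasurableSpace X] {H : Set (X → Bool)}
    {n T m : ℕ} {A : (Fin n → X × Bool) → X → Bool} {ε δ : ℝ} (hm : 1 ≤ m)
    (h : ∀ (m' : ℕ) [NeZero m'], m ≤ m' → ∀ μ : Measure X, IsProbabilityMeasure μ → ∀ c ∈ H,
      ENNReal.ofReal (1 - δ) ≤ adaBoostSuccess A T m' ε μ c) :
    adaBoostSampleComplexity H A T ε δ ≤ m :=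
  iInf₂_le m ⟨hm, h⟩

/-! ### Numerical form of the VC dimension bound -/

/-- The crude `log (4 T) ≤ 4 T` gives `dB = O((d + 1) T ^ 2)`; with `T = O(L)` and one more factor
`L` this is the cube. Both `L` and `K` are at least `1 / 2`, which absorbs the additive constants.
-/
theorem boosted_bound_le {d dB T : ℕ} {ε δ : ℝ} (hε : 0 < ε) (hε1 : ε < 1) (hδ : 0 < δ)
    (hδ1 : δ < 1) (hT1 : 1 ≤ T)
    (hdB : (dB : ℝ) ≤ 6 * (d * T * Real.log (4 * T) + T * Real.log 4))
    (hT : T = ⌈1000 * Real.log (2 / ε)⌉₊) :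
    1000 * (dB * Real.log (2 / ε) + Real.log (2 / δ)) / ε
      ≤ 10 ^ 12 * (d + Real.log (2 / δ)) / ε * Real.log (2 / ε) ^ 3 := by
  have hlog2 := Real.log_two_gt_d9
  have hT1' : (1 : ℝ) ≤ T := by exact_mod_cast hT1
  set L := Real.log (2 / ε) with hLdef
  set K := Real.log (2 / δ) with hKdef
  have hL : 1 / 2 ≤ L := by
    have : Real.log 2 ≤ L := Real.log_le_log (by norm_num) (by rw [le_div_iff₀ hε]; linarith)
    linarith
  have hK : 1 / 2 ≤ K := by
    have : Real.log 2 ≤ K := Real.log_le_log (by norm_num) (by rw [le_div_iff₀ hδ]; linarith)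
    linarith
  have hTL : (T : ℝ) ≤ 1002 * L := by
    have : (T : ℝ) < 1000 * L + 1 := by
      rw [hT]; exact Nat.ceil_lt_add_one (by positivity)
    linarith
  have hlogT : Real.log (4 * T) ≤ 4 * T := by
    linarith [Real.log_le_sub_one_of_pos (show (0 : ℝ) < 4 * T by positivity)]
  have hlog4 : Real.log 4 ≤ 3 := by
    linarith [Real.log_le_sub_one_of_pos (show (0 : ℝ) < 4 by norm_num)]
  have hd0 : (0 : ℝ) ≤ d := Nat.cast_nonneg _
  have h1 : (dB : ℝ) ≤ 24 * (d + 1) * T ^ 2 := by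
    calc (dB : ℝ) ≤ 6 * (d * T * (4 * T) + T * 3) := hdB.trans (by gcongr)
      _ ≤ _ := by nlinarith
  have h2 : (dB : ℝ) ≤ 24 * (d + 1) * (1002 * L) ^ 2 := h1.trans (by gcongr)
  have h3 : dB * L ≤ 24 * (d + 1) * (1002 * L) ^ 2 * L :=
    mul_le_mul_of_nonneg_right h2 (by linarith)
  have hL3 : 1 / 8 ≤ L ^ 3 := by
    calc (1 / 8 : ℝ) = (1 / 2) ^ 3 := by norm_num
      _ ≤ L ^ 3 := by gcongr
  rw [div_mul_eq_mul_div]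
  gcongr ?_ / ε
  have h4 : (d + 1) * L ^ 3 ≤ 2 * ((d + K) * L ^ 3) := by nlinarith
  have h5 : K ≤ 8 * ((d + K) * L ^ 3) := by nlinarith [mul_nonneg hd0 (by positivity : 0 ≤ L ^ 3)]
  have h6 : 0 ≤ (d + K) * L ^ 3 := by positivity
  nlinarith

end DistBoost

theorem proposition8 :
    ∃ C C' : ℝ, 0 < C ∧ 0 < C' ∧
      ∀ (X : Type*) [MeasurableSpace X] (H : Set (X → Bool)) (d : ℕ),
        (∀ h ∈ H, Measurable h) → DistBoost.vcDim H = d →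
      ∀ ε δ : ℝ, 0 < ε → ε < 1 → 0 < δ → δ < 1 →
      ∀ T : ℕ, C * Real.log (2 / ε) ≤ T →
      ∃ dBoost : ℕ, DistBoost.vcDim (DistBoost.boostedClass H T) = dBoost ∧
        (∀ (n : ℕ), C * (d + Real.log (2 * T / δ)) ≤ n →
          ∀ A : (Fin n → X × Bool) → X → Bool, DistBoost.IsConsistentLearner H A →
            Measurable (fun p : (Fin n → X × Bool) × X => A p.1 p.2) →
          ∀ (k : ℕ) [NeZero k],
            DistBoost.distBoostSampleComplexity H A T k ε δ
              = DistBoost.adaBoostSampleComplexity H A T ε δ ∧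
            DistBoost.distBoostSampleComplexity H A T k ε δ
              ≤ (⌈C * (dBoost * Real.log (2 / ε) + Real.log (2 / δ)) / ε⌉₊ : ℕ∞)) ∧
        (T = ⌈C * Real.log (2 / ε)⌉₊ →
          C * (dBoost * Real.log (2 / ε) + Real.log (2 / δ)) / ε
            ≤ C' * (d + Real.log (2 / δ)) / ε * Real.log (2 / ε) ^ 3) := by
  refine ⟨1000, 10 ^ 12, by norm_num, by norm_num, ?_⟩
  intro X _ H d hH hd ε δ hε hε1 hδ hδ1 T hT
  have hlogε : 0 < Real.log (2 / ε) := Real.log_pos (by rw [lt_div_iff₀ hε]; linarith)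
  have hlogδ : 0 < Real.log (2 / δ) := Real.log_pos (by rw [lt_div_iff₀ hδ]; linarith)
  have hT1 : 1 ≤ T := by
    have : (0 : ℝ) < T := lt_of_lt_of_le (by positivity) hT
    exact_mod_cast this
  set R : ℝ := 6 * (d * T * Real.log (4 * T) + T * Real.log 4) with hR
  have hcard : ∀ s, DistBoost.Shatters (DistBoost.boostedClass H T) s → (s.card : ℝ) ≤ R :=
    fun s hs => DistBoost.vcDim_boostedClass_le hd.le hT1 hs
  have hR0 : 0 ≤ R := by
    have hT' : (1 : ℝ) ≤ T := by exact_mod_cast hT1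
    have := Real.log_nonneg (show (1 : ℝ) ≤ 4 * T by linarith)
    have := Real.log_nonneg (show (1 : ℝ) ≤ 4 by norm_num)
    positivity
  have hfin : DistBoost.vcDim (DistBoost.boostedClass H T) ≤ (⌊R⌋₊ : ℕ∞) :=
    iSup₂_le fun s hs => by exact_mod_cast Nat.le_floor (hcard s hs)
  obtain ⟨dB, hdB⟩ := ENat.ne_top_iff_exists.1 (ne_top_of_le_ne_top (ENat.natCast_ne_top _) hfin)
  have hdBR : (dB : ℝ) ≤ R := by
    rw [← hdB] at hfin
    exact (Nat.cast_le.2 (by exact_mod_cast hfin)).trans (Nat.floor_le hR0)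
  refine ⟨dB, hdB.symm, ?_, DistBoost.boosted_bound_le hε hε1 hδ hδ1 hT1 hdBR⟩
  intro n hn A hA hAm k _
  have heq := DistBoost.distBoostSampleComplexity_eq H A T k ε δ
  refine ⟨heq, heq.trans_le (DistBoost.adaBoostSampleComplexity_le ?_ ?_)⟩
  · exact Nat.one_le_ceil_iff.2 (by positivity)
  · intro m' _ hm' μ _ c hc
    exact DistBoost.adaBoostSuccess_ge hH hd.le hdB.ge hε hε1 hδ hδ1 hT hT1 hn hA hAm
      (Nat.ceil_le.1 hm') μ hc
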